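/- Let $n\in\mathbb C$. For an integer $k\ge 0$ let $A_k$ be the set of set partitions of $\{1,\dots,k,1',\dots,k'\}$ (drawn as diagrams with top row $1,\dots,k$ and bottom row $1',\dots,k'$), and let $A_{k+1/2}\subseteq A_{k+1}$ be the set of those in which $k+1$ and $(k+1)'$ lie in the same block. The propagating number $pn(d)$ is the number of blocks of $d$ that meet both rows (for $d\in A_{k+1/2}$ it is computed in $A_{k+1}$). The partition algebra $\mathbb CA_k(n)$, $k\in\frac12\mathbb Z_{\ge0}$, has basis $A_k$ and product $d_1d_2=n^{\ell}\,(d_1\circ d_2)$, where $d_1\circ d_2$ is obtained by placing $d_1$ above $d_2$, identifying the bottom row of $d_1$ with the top row of $d_2$, and removing the $\ell$ connected components that lie entirely in the middle row. For integers $k\ge1$ there are inclusions $\mathbb CA_{k-1}(n)\hookrightarrow\mathbb CA_{k-1/2}(n)$ (add the block $\{k,k'\}$) and $\mathbb CA_{k-1/2}(n)\subseteq\mathbb CA_k(n)$. Let $S_k$ be the symmetric group, with $S_{k+1/2}=S_k$ for integers $k\ge 0$, viewed inside $A_k$ (resp. $A_{k+1/2}$) as permutation diagrams (resp. with the block $\{k+1,(k+1)'\}$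 added). For $k\in\frac12\mathbb Z_{\ge0}$ let $\mathbb CI_k(n)\subseteq\mathbb CA_k(n)$ be the span of the $d\in A_k$ with $pn(d)<k$. For an integer $k\ge1$ let $p_k\in A_k$ be the diagram with blocks $\{k\}$, $\{k'\}$ and $\{j,j'\}$ for $j<k$, and let $p_{k+1/2}\in A_{k+1/2}$ be the diagram with blocks $\{k,k+1,k',(k+1)'\}$ and $\{j,j'\}$ for $j<k$. Define bimodule maps as follows: for an integer $k\ge1$, $\varepsilon_{k+1/2}\colon\mathbb CA_k(n)\to\mathbb CA_{k-1/2}(n)$ combines the blocks of $d$ containing $k$ and $k'$; and $\varepsilon_{k}\colon\mathbb CA_{k-1/2}(n)\to\mathbb CA_{k-1}(n)$ removes $k$ and $k'$ from $d$, with a factor $n$ if this reduces the number of blocks. For $k\in\frac12\mathbb Z$, $k\ge1$, the basic construction is the (nonunital) algebra $\mathbb CA_{k-1/2}(n)\otimes_{\mathbb CA_{k-1}(n)}\mathbb CA_{k-1/2}(n)$ with product $(b_1\otimes b_2)(b_3\otimes b_4)=b_1\otimes\varepsilon_k(b_2b_3)\,b_4$. Then: (1) For every $k\in\frac12\mathbb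 Z$ with $k\ge1$, the map $b_1\otimes b_2\mapsto b_1p_kb_2$ is a well-defined isomorphism of algebras from $\mathbb CA_{k-1/2}(n)\otimes_{\mathbb CA_{k-1}(n)}\mathbb CA_{k-1/2}(n)$ onto $\mathbb CI_k(n)$. (2) For every $k\in\frac12\mathbb Z_{\ge0}$, $\mathbb CI_k(n)$ is a two-sided ideal of $\mathbb CA_k(n)$, and there is an algebra isomorphism $\mathbb CA_k(n)/\mathbb CI_k(n)\cong\mathbb CS_k$ which sends the class of each permutation diagram to the corresponding permutation. -/

import Mathlib

open scoped TensorProduct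

noncomputable section

/-! ## Set partitions on two rows and their composition -/

namespace SetPartition

variable {V W X Y Z : Type}

/-- The number of blocks of `r` that contain no element `f x`: these are the blocks that disappear
when `r` is restricted to the image of `f`. -/
def lost (r : Setoid V) (f : X → V) : ℕ :=
  Nat.card {q : Quotient r // ∀ x, Quotient.mk r (f x) ≠ q}

/-- The finest set partition with `u` and `v` in the same block. -/
def glue (u v : V) : Setoid V :=
  Relation.EqvGen.setoid fun a b => a = u ∧ b = v

/-- Connected components of the graph on three rows `X`, `Y`, `Z` (top, middle, bottom) obtained by
placing `d` above `e` and identifying the bottom row of `d` with the top row of `e`. -/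
def stack (d : Setoid (X ⊕ Y)) (e : Setoid (Y ⊕ Z)) : Setoid (X ⊕ (Y ⊕ Z)) :=
  d.map (Sum.map id Sum.inl) ⊔ e.map Sum.inr

/-- The composition `d ∘ e`: restrict the stack to the top and the bottom row. -/
def comp (d : Setoid (X ⊕ Y)) (e : Setoid (Y ⊕ Z)) : Setoid (X ⊕ Z) :=
  (stack d e).comap (Sum.map id Sum.inr)

/-- The number of components of the stack that live entirely in the middle row. -/
def loops (d : Setoid (X ⊕ Y)) (e : Setoid (Y ⊕ Z)) : ℕ :=
  lost (stack d e) (Sum.map id Sum.inr : X ⊕ Z → X ⊕ (Y ⊕ Z))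

/-! ### Counting two-colourings

Identities between diagrams are proved by counting the colourings with two colours that are
constant on blocks. -/

open Classical in
/-- `1` if the colouring `c` is constant on the blocks of `r`, and `0` otherwise. -/
def wt (r : Setoid V) (c : V → Bool) : ℕ := if r ≤ Setoid.ker c then 1 else 0

theorem wt_sup (r s : Setoid V) (c : V → Bool) : wt (r ⊔ s) c = wt r c * wt s c := by
  unfold wt
  by_cases h1 : r ≤ Setoid.ker c <;> by_cases h2 : s ≤ Setoid.ker c <;> simp [h1, h2]

theorem map_le_ker_iff (r : Setoid W) (f : W → V) (c : V → Bool) :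
    r.map f ≤ Setoid.ker c ↔ r ≤ Setoid.ker (c ∘ f) := by
  constructor
  · intro h a b hab
    exact h (Relation.EqvGen.rel _ _ ⟨a, b, hab, rfl, rfl⟩)
  · intro h
    refine Setoid.eqvGen_le ?_
    rintro _ _ ⟨a, b, hab, rfl, rfl⟩
    exact h hab

theorem wt_map (r : Setoid W) (f : W → V) (c : V → Bool) :
    wt (r.map f) c = wt r (c ∘ f) := by
  unfold wt
  by_cases h : r ≤ Setoid.ker (c ∘ f)
  · rw [if_pos h, if_pos ((map_le_ker_iff r f c).2 h)]
  · rw [if_neg h, if_neg fun h' => h ((map_le_ker_iff r f c).1 h')]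

theorem wt_glue (u v : V) (c : V → Bool) : wt (glue u v) c = if c u = c v then 1 else 0 := by
  unfold wt
  congr 1
  apply propext
  constructor
  · intro h
    exact h (Relation.EqvGen.rel _ _ ⟨rfl, rfl⟩)
  · intro h
    refine Setoid.eqvGen_le ?_
    rintro _ _ ⟨rfl, rfl⟩
    exact h

theorem wt_ker {T : Type} (g : V → T) (c : V → Bool) [Decidable (∀ a b, g a = g b → c a = c b)] :
    wt (Setoid.ker g) c = if ∀ a b, g a = g b → c a = c b then 1 else 0 := by
  unfold wt
  congr 1

/-- A power of two times a set partition is determined by the counts of colourings. -/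
theorem scaled_ext {r s : Setoid V} {a b : ℕ}
    (h : ∀ c, 2 ^ a * wt r c = 2 ^ b * wt s c) : a = b ∧ r = s := by
  classical
  have h0 := h fun _ => true
  have hc : ∀ t : Setoid V, wt t (fun _ => true) = 1 := fun t => by
    unfold wt
    rw [if_pos]
    intro x y _
    rfl
  rw [hc, hc, mul_one, mul_one] at h0
  have hab : a = b := Nat.pow_right_injective le_rfl h0
  subst hab
  refine ⟨rfl, ?_⟩
  have key : ∀ c : V → Bool, r ≤ Setoid.ker c ↔ s ≤ Setoid.ker c := by
    intro c
    have h1 := Nat.eq_of_mul_eq_mul_left (by positivity) (h c)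
    unfold wt at h1
    by_cases h2 : r ≤ Setoid.ker c <;> by_cases h3 : s ≤ Setoid.ker c <;> simp_all
  have self : ∀ (t : Setoid V) (x : V), t ≤ Setoid.ker fun v => decide (t x v) := by
    intro t x u v huv
    simp only [Setoid.ker_def, decide_eq_decide]
    exact ⟨fun hh => t.trans hh huv, fun hh => t.trans hh (t.symm huv)⟩
  ext x y
  constructor
  · intro hxy
    have := (key _).2 (self s x) hxy
    simp only [Setoid.ker_def, decide_eq_decide] at this
    exact this.1 (s.refl x)
  · intro hxy
    have := (key _).1 (self r x) hxy
    simp only [Setoid.ker_def, decide_eq_decide] at this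
    exact this.1 (r.refl x)

/-- The number of block-constant extensions of a colouring `x` along `f`. -/
theorem card_extensions [Finite V] (r : Setoid V) (f : X → V) (x : X → Bool) :
    Nat.card {c : V → Bool // r ≤ Setoid.ker c ∧ c ∘ f = x} =
      2 ^ lost r f * wt (r.comap f) x := by
  classical
  by_cases hx : r.comap f ≤ Setoid.ker x
  · rw [wt, if_pos hx, mul_one, lost]
    let L := {q : Quotient r // ∀ x, Quotient.mk r (f x) ≠ q}
    let F : {c : V → Bool // r ≤ Setoid.ker c ∧ c ∘ f = x} → (L → Bool) :=
      fun c q => Quotient.lift c.1 (fun a b h => c.2.1 h) q.1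
    have hF : Function.Bijective F := by
      constructor
      · rintro ⟨c, hc, hcx⟩ ⟨c', hc', hcx'⟩ h
        apply Subtype.ext
        funext v
        change c v = c' v
        by_cases hv : ∃ y, r (f y) v
        · obtain ⟨y, hy⟩ := hv
          have e1 : c (f y) = c v := hc hy
          have e2 : c' (f y) = c' v := hc' hy
          rw [← e1, ← e2]
          exact (congrFun hcx y).trans (congrFun hcx' y).symm
        · exact congrFun h ⟨Quotient.mk r v, fun y hy => hv ⟨y, Quotient.exact hy⟩⟩
      · intro g
        let c : V → Bool := fun v =>
          if hv : ∃ y, r (f y) v then x hv.choose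
          else g ⟨Quotient.mk r v, fun y hy => hv ⟨y, Quotient.exact hy⟩⟩
        have hc : r ≤ Setoid.ker c := by
          intro u v huv
          change c u = c v
          by_cases hu : ∃ y, r (f y) u
          · have hv : ∃ y, r (f y) v := ⟨hu.choose, r.trans hu.choose_spec huv⟩
            simp only [c, dif_pos hu, dif_pos hv]
            exact hx (r.trans hu.choose_spec (r.trans huv (r.symm hv.choose_spec)))
          · have hv : ¬ ∃ y, r (f y) v := fun ⟨y, hy⟩ => hu ⟨y, r.trans hy (r.symm huv)⟩
            simp only [c, dif_neg hu, dif_neg hv]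
            congr 2
            exact Quotient.sound huv
        refine ⟨⟨c, hc, ?_⟩, ?_⟩
        · funext y
          have hy : ∃ z, r (f z) (f y) := ⟨y, r.refl _⟩
          simp only [c, Function.comp, dif_pos hy]
          exact hx hy.choose_spec
        · funext q
          obtain ⟨q, hq⟩ := q
          induction q using Quotient.inductionOn with
          | h v =>
            have hv : ¬ ∃ y, r (f y) v := fun ⟨y, hy⟩ => hq y (Quotient.sound hy)
            simp only [F, Quotient.lift_mk, c, dif_neg hv]
    rw [Nat.card_congr (Equiv.ofBijective F hF)]
    have : Fintype L := Fintype.ofFinite L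
    rw [Nat.card_eq_fintype_card, Nat.card_eq_fintype_card, Fintype.card_fun, Fintype.card_bool]
  · rw [wt, if_neg hx, mul_zero]
    rw [Nat.card_eq_zero]
    left
    constructor
    rintro ⟨c, hc, rfl⟩
    exact hx fun a b hab => hc hab

theorem wt_stack (d : Setoid (X ⊕ Y)) (e : Setoid (Y ⊕ Z)) (x : X → Bool) (y : Y → Bool)
    (z : Z → Bool) : wt (stack d e) (Sum.elim x (Sum.elim y z)) =
      wt d (Sum.elim x y) * wt e (Sum.elim y z) := by
  rw [stack, wt_sup, wt_map, wt_map]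
  congr 2
  funext v
  cases v <;> rfl

theorem sum_wt_mul_wt [Fintype X] [Fintype Y] [Fintype Z] [DecidableEq Y]
    (d : Setoid (X ⊕ Y)) (e : Setoid (Y ⊕ Z)) (x : X → Bool) (z : Z → Bool) :
    ∑ y : Y → Bool, wt d (Sum.elim x y) * wt e (Sum.elim y z) =
      2 ^ loops d e * wt (comp d e) (Sum.elim x z) := by
  classical
  rw [loops, comp, ← card_extensions]
  simp only [← wt_stack]
  have h1 : ∀ y : Y → Bool, wt (stack d e) (Sum.elim x (Sum.elim y z)) =
      if stack d e ≤ Setoid.ker (Sum.elim x (Sum.elim y z)) then 1 else 0 := fun y => by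
    unfold wt
    congr 1
  simp only [h1, Finset.sum_boole, Nat.cast_id]
  rw [← Fintype.card_subtype, ← Nat.card_eq_fintype_card]
  refine Nat.card_congr
    { toFun := fun y => ⟨Sum.elim x (Sum.elim y.1 z), y.2, ?_⟩
      invFun := fun c => ⟨fun y => c.1 (Sum.inr (Sum.inl y)), ?_⟩
      left_inv := fun y => rfl
      right_inv := fun c => ?_ }
  · funext v
    cases v <;> rfl
  · obtain ⟨c, hc, hcx⟩ := c
    convert hc using 2
    funext v
    rcases v with v | v | v
    · exact (congrFun hcx (Sum.inl v)).symm
    · rfl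
    · exact (congrFun hcx (Sum.inr v)).symm
  · obtain ⟨c, hc, hcx⟩ := c
    apply Subtype.ext
    funext v
    rcases v with v | v | v
    · exact (congrFun hcx (Sum.inl v)).symm
    · rfl
    · exact (congrFun hcx (Sum.inr v)).symm

theorem elim_surj (c : X ⊕ Y → Bool) : ∃ x y, c = Sum.elim x y :=
  ⟨c ∘ Sum.inl, c ∘ Sum.inr, (Sum.elim_comp_inl_inr c).symm⟩

theorem assoc_aux {T : Type} [Fintype X] [Fintype Y] [Fintype Z] [Fintype T]
    (d : Setoid (X ⊕ Y)) (e : Setoid (Y ⊕ Z)) (f : Setoid (Z ⊕ T)) :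
    loops d e + loops (comp d e) f = loops e f + loops d (comp e f) ∧
      comp (comp d e) f = comp d (comp e f) := by
  classical
  refine scaled_ext fun c => ?_
  obtain ⟨x, t, rfl⟩ := elim_surj c
  rw [pow_add, pow_add, mul_assoc, mul_assoc, ← sum_wt_mul_wt, ← sum_wt_mul_wt,
    Finset.mul_sum, Finset.mul_sum]
  simp only [← mul_assoc, ← sum_wt_mul_wt, Finset.sum_mul]
  rw [Finset.sum_comm]
  refine Finset.sum_congr rfl fun y _ => ?_
  rw [mul_comm (2 ^ _) (wt d _), mul_assoc, ← sum_wt_mul_wt, Finset.mul_sum]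
  simp only [mul_assoc]

end SetPartition

/-! ## Partition diagrams -/

/-- `A_m`: set partitions of `{1, …, m, 1', …, m'}`; `Sum.inl i` is the `i`-th vertex of the top row
and `Sum.inr i` is the `i`-th vertex of the bottom row. -/
abbrev Diagram (m : ℕ) : Type := Setoid (Fin m ⊕ Fin m)

namespace Diagram

open SetPartition

/-- The number of blocks that meet both the top and the bottom row. -/
def pn {m : ℕ} (d : Diagram m) : ℕ :=
  Nat.card {q : Quotient d // (∃ i, Quotient.mk d (Sum.inl i) = q) ∧
    ∃ j, Quotient.mk d (Sum.inr j) = q}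

/-- `A_{m+1/2}`: the diagrams in `A_{m+1}` with `m+1` and `(m+1)'` in the same block. -/
def IsHalf {m : ℕ} (d : Diagram (m + 1)) : Prop :=
  d (Sum.inl (Fin.last m)) (Sum.inr (Fin.last m))

/-- The identity diagram, with blocks `{i, i'}`. -/
def one (m : ℕ) : Diagram m := Setoid.ker (Sum.elim (fun i => i) fun i => i)

/-- The diagram of a permutation, with blocks `{σ(j), j'}`. -/
def ofPerm {m : ℕ} (σ : Equiv.Perm (Fin m)) : Diagram m :=
  Setoid.ker (Sum.elim (fun i => i) fun j => σ j)

/-- Add a vertical strand on the right: the blocks are those of `d` and `{m+1, (m+1)'}`. -/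
def addStrand {m : ℕ} (d : Diagram m) : Diagram (m + 1) :=
  d.map (Sum.map Fin.castSucc Fin.castSucc) ⊔
    glue (Sum.inl (Fin.last m)) (Sum.inr (Fin.last m))

/-- Combine the blocks containing the last top vertex and the last bottom vertex. -/
def mergeLast {m : ℕ} (d : Diagram (m + 1)) : Diagram (m + 1) :=
  d ⊔ glue (Sum.inl (Fin.last m)) (Sum.inr (Fin.last m))

/-- Remove the last top vertex and the last bottom vertex from their blocks. -/
def removeLast {m : ℕ} (d : Diagram (m + 1)) : Diagram m :=
  d.comap (Sum.map Fin.castSucc Fin.castSucc)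

/-- The number of blocks that disappear when the last vertices of both rows are removed. -/
def removedBlocks {m : ℕ} (d : Diagram (m + 1)) : ℕ :=
  lost d (Sum.map Fin.castSucc Fin.castSucc : Fin m ⊕ Fin m → _)

/-- `p_j`: the blocks are `{i, i'}` for `i ≠ j`, together with the singletons `{j}` and `{j'}`. -/
def p {m : ℕ} (j : Fin m) : Diagram m :=
  Setoid.ker (Sum.elim (fun i => (i, decide (i = j))) fun i => (i, false))

/-- `p_{i+1/2}` for neighbouring vertices `i` and `i + 1`: the blocks are `{i, i+1, i', (i+1)'}`
and `{j, j'}` for `j ≠ i, i+1`. -/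
def pHalf {m : ℕ} (i : Fin m) : Diagram (m + 1) :=
  Setoid.ker (Sum.elim (fun j => if j = i.succ then i.castSucc else j)
    fun j => if j = i.succ then i.castSucc else j)

theorem wt_one {m : ℕ} (x y : Fin m → Bool) :
    wt (one m) (Sum.elim x y) = if x = y then 1 else 0 := by
  rw [one, wt_ker]
  congr 1
  apply propext
  constructor
  · intro h
    funext i
    exact h (Sum.inl i) (Sum.inr i) rfl
  · rintro rfl (a | a) (b | b) h <;> exact congrArg x h

theorem one_comp_aux {m : ℕ} (d : Diagram m) : loops (one m) d = 0 ∧ comp (one m) d = d := by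
  classical
  refine scaled_ext fun c => ?_
  obtain ⟨x, z, rfl⟩ := elim_surj c
  rw [← sum_wt_mul_wt]
  simp [wt_one]

theorem comp_one_aux {m : ℕ} (d : Diagram m) : loops d (one m) = 0 ∧ comp d (one m) = d := by
  classical
  refine scaled_ext fun c => ?_
  obtain ⟨x, z, rfl⟩ := elim_surj c
  rw [← sum_wt_mul_wt]
  simp [wt_one]

theorem snoc_surj {m : ℕ} (x : Fin (m + 1) → Bool) :
    ∃ (x' : Fin m → Bool) (s : Bool), x = Fin.snoc x' s :=
  ⟨fun i => x i.castSucc, x (Fin.last m), (Fin.snoc_init_self x).symm⟩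

theorem sum_snoc {m : ℕ} (F : (Fin (m + 1) → Bool) → ℕ) :
    ∑ y, F y = ∑ s : Bool, ∑ y : Fin m → Bool, F (Fin.snoc y s) := by
  rw [← (Fin.snocEquiv fun _ => Bool).sum_comp, Fintype.sum_prod_type]
  rfl

theorem elim_snoc_comp {m : ℕ} (x y : Fin m → Bool) (s t : Bool) :
    (Sum.elim (Fin.snoc x s : Fin (m + 1) → Bool) (Fin.snoc y t : Fin (m + 1) → Bool)) ∘
      Sum.map Fin.castSucc Fin.castSucc = Sum.elim x y := by
  funext v
  cases v <;> simp

theorem wt_addStrand {m : ℕ} (d : Diagram m) (x y : Fin m → Bool) (s t : Bool) :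
    wt d.addStrand (Sum.elim (Fin.snoc x s : Fin (m + 1) → Bool) (Fin.snoc y t)) =
      if s = t then wt d (Sum.elim x y) else 0 := by
  rw [addStrand, wt_sup, wt_map, wt_glue, elim_snoc_comp]
  simp

theorem wt_mergeLast {m : ℕ} (d : Diagram (m + 1)) (x y : Fin m → Bool) (s t : Bool) :
    wt d.mergeLast (Sum.elim (Fin.snoc x s : Fin (m + 1) → Bool) (Fin.snoc y t)) =
      if s = t then wt d (Sum.elim (Fin.snoc x s : Fin (m + 1) → Bool) (Fin.snoc y t)) else 0 := by
  rw [mergeLast, wt_sup, wt_glue]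
  simp

theorem IsHalf.wt_eq_zero {m : ℕ} {d : Diagram (m + 1)} (h : d.IsHalf) (x y : Fin m → Bool)
    {s t : Bool} (hst : s ≠ t) :
    wt d (Sum.elim (Fin.snoc x s : Fin (m + 1) → Bool) (Fin.snoc y t)) = 0 := by
  unfold wt
  rw [if_neg]
  intro hd
  have := hd h
  simp at this
  exact hst this

theorem sum_wt_removeLast {m : ℕ} (d : Diagram (m + 1)) (x y : Fin m → Bool) :
    ∑ s : Bool, ∑ t : Bool, wt d (Sum.elim (Fin.snoc x s : Fin (m + 1) → Bool) (Fin.snoc y t)) =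
      2 ^ d.removedBlocks * wt d.removeLast (Sum.elim x y) := by
  classical
  rw [removedBlocks, removeLast, ← card_extensions, ← Fintype.sum_prod_type']
  have h1 : ∀ p : Bool × Bool,
      wt d (Sum.elim (Fin.snoc x p.1 : Fin (m + 1) → Bool) (Fin.snoc y p.2)) =
      if d ≤ Setoid.ker (Sum.elim (Fin.snoc x p.1 : Fin (m + 1) → Bool) (Fin.snoc y p.2))
        then 1 else 0 := fun p => by
    unfold wt
    congr 1
  simp only [h1, Finset.sum_boole, Nat.cast_id]
  rw [← Fintype.card_subtype, ← Nat.card_eq_fintype_card]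
  refine Nat.card_congr
    { toFun := fun p => ⟨Sum.elim (Fin.snoc x p.1.1 : Fin (m + 1) → Bool) (Fin.snoc y p.1.2),
        p.2, elim_snoc_comp _ _ _ _⟩
      invFun := fun c => ⟨(c.1 (Sum.inl (Fin.last m)), c.1 (Sum.inr (Fin.last m))), ?_⟩
      left_inv := fun p => by simp
      right_inv := fun c => ?_ }
  all_goals
    obtain ⟨c, hc, hcx⟩ := c
    have hcc : Sum.elim (Fin.snoc x (c (Sum.inl (Fin.last m))) : Fin (m + 1) → Bool)
        (Fin.snoc y (c (Sum.inr (Fin.last m)))) = c := by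
      funext v
      rcases v with v | v
      · induction v using Fin.lastCases with
        | last => simp
        | cast v => simpa using (congrFun hcx (Sum.inl v)).symm
      · induction v using Fin.lastCases with
        | last => simp
        | cast v => simpa using (congrFun hcx (Sum.inr v)).symm
  · exact hcc.symm ▸ hc
  · exact Subtype.ext hcc

theorem addStrand_comp_aux {m : ℕ} (d e : Diagram m) :
    loops d.addStrand e.addStrand = loops d e ∧
      comp d.addStrand e.addStrand = addStrand (comp d e) := by
  classical
  refine scaled_ext fun c => ?_
  obtain ⟨x, z, rfl⟩ := elim_surj c
  obtain ⟨x, s, rfl⟩ := snoc_surj x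
  obtain ⟨z, t, rfl⟩ := snoc_surj z
  rw [← sum_wt_mul_wt, sum_snoc]
  simp only [wt_addStrand, mul_ite, mul_zero, ← sum_wt_mul_wt]
  cases s <;> cases t <;> simp

theorem addStrand_one {m : ℕ} : (one m).addStrand = one (m + 1) := by
  classical
  refine (scaled_ext (a := 0) (b := 0) fun c => ?_).2
  obtain ⟨x, z, rfl⟩ := elim_surj c
  obtain ⟨x, s, rfl⟩ := snoc_surj x
  obtain ⟨z, t, rfl⟩ := snoc_surj z
  rw [wt_addStrand, wt_one, wt_one]
  by_cases h1 : s = t <;> by_cases h2 : x = z <;> simp [h1, h2, Fin.snoc_inj]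

theorem isHalf_one {m : ℕ} : (one (m + 1)).IsHalf := rfl

theorem isHalf_addStrand {m : ℕ} (d : Diagram m) : d.addStrand.IsHalf :=
  (le_sup_right : _ ≤ d.addStrand) (Relation.EqvGen.rel _ _ ⟨rfl, rfl⟩)

theorem isHalf_mergeLast {m : ℕ} (d : Diagram (m + 1)) : d.mergeLast.IsHalf :=
  (le_sup_right : _ ≤ d.mergeLast) (Relation.EqvGen.rel _ _ ⟨rfl, rfl⟩)

theorem IsHalf.comp {m : ℕ} {d e : Diagram (m + 1)} (hd : d.IsHalf) (he : e.IsHalf) :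
    IsHalf (comp d e : Diagram (m + 1)) := by
  have h1 : stack d e (Sum.inl (Fin.last m)) (Sum.inr (Sum.inl (Fin.last m))) :=
    (le_sup_left : _ ≤ stack d e) (Relation.EqvGen.rel _ _ ⟨_, _, hd, rfl, rfl⟩)
  have h2 : stack d e (Sum.inr (Sum.inl (Fin.last m))) (Sum.inr (Sum.inr (Fin.last m))) :=
    (le_sup_right : _ ≤ stack d e) (Relation.EqvGen.rel _ _ ⟨_, _, he, rfl, rfl⟩)
  exact (stack d e).trans h1 h2

theorem isHalf_pHalf {m : ℕ} (i : Fin m) : (pHalf i).IsHalf := rfl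

theorem mergeLast_left_aux {m : ℕ} {d : Diagram (m + 1)} (hd : d.IsHalf) (e : Diagram (m + 1)) :
    loops d e = loops d e.mergeLast ∧
      mergeLast (comp d e) = comp d e.mergeLast := by
  classical
  refine scaled_ext fun c => ?_
  obtain ⟨x, z, rfl⟩ := elim_surj c
  obtain ⟨x, s, rfl⟩ := snoc_surj x
  obtain ⟨z, t, rfl⟩ := snoc_surj z
  rw [wt_mergeLast, mul_ite, ← sum_wt_mul_wt, ← sum_wt_mul_wt, sum_snoc, sum_snoc]
  simp only [wt_mergeLast]
  cases s <;> cases t <;> simp [hd.wt_eq_zero]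

theorem mergeLast_right_aux {m : ℕ} (d : Diagram (m + 1)) {e : Diagram (m + 1)} (he : e.IsHalf) :
    loops d e = loops d.mergeLast e ∧
      mergeLast (comp d e) = comp d.mergeLast e := by
  classical
  refine scaled_ext fun c => ?_
  obtain ⟨x, z, rfl⟩ := elim_surj c
  obtain ⟨x, s, rfl⟩ := snoc_surj x
  obtain ⟨z, t, rfl⟩ := snoc_surj z
  rw [wt_mergeLast, mul_ite, ← sum_wt_mul_wt, ← sum_wt_mul_wt, sum_snoc, sum_snoc]
  simp only [wt_mergeLast]
  cases s <;> cases t <;> simp [he.wt_eq_zero]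

theorem removeLast_left_aux {m : ℕ} (d : Diagram m) (e : Diagram (m + 1)) :
    loops d.addStrand e + removedBlocks (comp d.addStrand e) =
        removedBlocks e + loops d e.removeLast ∧
      removeLast (comp d.addStrand e) = comp d e.removeLast := by
  classical
  refine scaled_ext fun c => ?_
  obtain ⟨x, z, rfl⟩ := elim_surj c
  rw [pow_add, pow_add, mul_assoc, mul_assoc, ← sum_wt_removeLast, ← sum_wt_mul_wt]
  simp only [Finset.mul_sum, ← sum_wt_mul_wt, sum_snoc, wt_addStrand]
  simp only [mul_left_comm (2 ^ _), ← sum_wt_removeLast, Fintype.sum_bool]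
  simp [← Finset.sum_add_distrib, mul_add]

theorem removeLast_right_aux {m : ℕ} (d : Diagram (m + 1)) (e : Diagram m) :
    loops d e.addStrand + removedBlocks (comp d e.addStrand) =
        removedBlocks d + loops d.removeLast e ∧
      removeLast (comp d e.addStrand) = comp d.removeLast e := by
  classical
  refine scaled_ext fun c => ?_
  obtain ⟨x, z, rfl⟩ := elim_surj c
  rw [pow_add, pow_add, mul_assoc, mul_assoc, ← sum_wt_removeLast, ← sum_wt_mul_wt]
  simp only [Finset.mul_sum, ← sum_wt_mul_wt, sum_snoc, wt_addStrand]
  simp only [← mul_assoc, ← sum_wt_removeLast, Fintype.sum_bool]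
  simp [← Finset.sum_add_distrib, add_mul]

end Diagram

/-! ## Partition algebras -/

/-- The partition algebra `ℂA_m(n)` for an integer `m`: the complex vector space with basis `A_m`. -/
def PartitionAlgebra (m : ℕ) (_n : ℂ) : Type := Diagram m →₀ ℂ

namespace PartitionAlgebra

open SetPartition

variable {m : ℕ} {n : ℂ}

instance : AddCommGroup (PartitionAlgebra m n) := inferInstanceAs (AddCommGroup (Diagram m →₀ ℂ))

instance : Module ℂ (PartitionAlgebra m n) := inferInstanceAs (Module ℂ (Diagram m →₀ ℂ))

/-- The basis vector of a diagram. -/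
def diag (n : ℂ) (d : Diagram m) : PartitionAlgebra m n := Finsupp.single d 1

/-- The linear map with prescribed values on the basis of diagrams. -/
def lift (n : ℂ) {M : Type} [AddCommGroup M] [Module ℂ M] (v : Diagram m → M) :
    PartitionAlgebra m n →ₗ[ℂ] M :=
  Finsupp.linearCombination ℂ v

@[simp]
theorem lift_diag {M : Type} [AddCommGroup M] [Module ℂ M] (v : Diagram m → M) (d : Diagram m) :
    lift n v (diag n d) = v d :=
  (Finsupp.linearCombination_single ℂ 1 d).trans (one_smul ℂ _)

theorem hom_ext {M : Type} [AddCommGroup M] [Module ℂ M] {f g : PartitionAlgebra m n →ₗ[ℂ] M}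
    (h : ∀ d, f (diag n d) = g (diag n d)) : f = g :=
  Finsupp.lhom_ext' fun d => LinearMap.ext_ring (h d)

/-- The multiplication `d e = n ^ ℓ (d ∘ e)`, where `ℓ` is the number of components removed from
the middle row. -/
def mulHom (m : ℕ) (n : ℂ) :
    PartitionAlgebra m n →ₗ[ℂ] PartitionAlgebra m n →ₗ[ℂ] PartitionAlgebra m n :=
  lift n fun d => lift n fun e => n ^ loops d e • diag n (comp d e)

instance : Mul (PartitionAlgebra m n) := ⟨fun x y => mulHom m n x y⟩

instance : One (PartitionAlgebra m n) := ⟨diag n (Diagram.one m)⟩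

theorem mul_def (x y : PartitionAlgebra m n) : x * y = mulHom m n x y := rfl

theorem one_def : (1 : PartitionAlgebra m n) = diag n (Diagram.one m) := rfl

theorem diag_mul_diag (d e : Diagram m) :
    diag n d * diag n e = n ^ loops d e • diag n (comp d e) := by
  simp [mul_def, mulHom]

theorem mul_assoc_aux (x y z : PartitionAlgebra m n) : x * y * z = x * (y * z) := by
  have h : (LinearMap.compr₂ (mulHom m n) (mulHom m n)) =
      (LinearMap.llcomp ℂ _ _ _ ∘ₗ mulHom m n).compl₂ (mulHom m n) := by
    refine hom_ext fun d => hom_ext fun e => hom_ext fun f => ?_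
    change diag n d * diag n e * diag n f = diag n d * (diag n e * diag n f)
    simp only [diag_mul_diag]
    simp only [mul_def, map_smul, LinearMap.smul_apply]
    simp only [← mul_def, diag_mul_diag, smul_smul, ← pow_add]
    rw [(assoc_aux d e f).1, (assoc_aux d e f).2]
  exact LinearMap.congr_fun (LinearMap.congr_fun (LinearMap.congr_fun h x) y) z

theorem one_mul_aux (x : PartitionAlgebra m n) : 1 * x = x := by
  have h : mulHom m n 1 = LinearMap.id := hom_ext fun d => by
    rw [← mul_def, one_def, diag_mul_diag, (Diagram.one_comp_aux d).1, (Diagram.one_comp_aux d).2]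
    simp
  exact LinearMap.congr_fun h x

theorem mul_one_aux (x : PartitionAlgebra m n) : x * 1 = x := by
  have h : (mulHom m n).flip 1 = LinearMap.id := hom_ext fun d => by
    rw [LinearMap.flip_apply, ← mul_def, one_def, diag_mul_diag, (Diagram.comp_one_aux d).1,
      (Diagram.comp_one_aux d).2]
    simp
  exact LinearMap.congr_fun h x

instance : Ring (PartitionAlgebra m n) :=
  { (inferInstance : AddCommGroup (PartitionAlgebra m n)) with
    mul := (· * ·)
    one := 1
    left_distrib := fun x y z => map_add (mulHom m n x) y z
    right_distrib := fun x y z => LinearMap.map_add₂ (mulHom m n) x y z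
    zero_mul := fun x => LinearMap.map_zero₂ (mulHom m n) x
    mul_zero := fun x => map_zero (mulHom m n x)
    mul_assoc := mul_assoc_aux
    one_mul := one_mul_aux
    mul_one := mul_one_aux }

instance : Algebra ℂ (PartitionAlgebra m n) :=
  Algebra.ofModule (fun r x y => LinearMap.map_smul₂ (mulHom m n) r x y)
    fun r x y => map_smul (mulHom m n x) r y

/-- `ℂA_{m+1/2}(n)`: the span of `A_{m+1/2}`, a subalgebra of `ℂA_{m+1}(n)`. -/
def half (m : ℕ) (n : ℂ) : Subalgebra ℂ (PartitionAlgebra (m + 1) n) :=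
  (Submodule.span ℂ {x | ∃ d : Diagram (m + 1), d.IsHalf ∧ x = diag n d}).toSubalgebra
    (Submodule.subset_span ⟨_, Diagram.isHalf_one, one_def⟩) (by
      intro x y hx hy
      induction hx, hy using Submodule.span_induction₂ with
      | mem_mem x y hx hy =>
        obtain ⟨d, hd, rfl⟩ := hx
        obtain ⟨e, he, rfl⟩ := hy
        rw [diag_mul_diag]
        exact Submodule.smul_mem _ _ (Submodule.subset_span ⟨_, hd.comp he, rfl⟩)
      | zero_left y hy => rw [zero_mul]; exact Submodule.zero_mem _
      | zero_right x hx => rw [mul_zero]; exact Submodule.zero_mem _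
      | add_left x y z _ _ _ h1 h2 => rw [add_mul]; exact Submodule.add_mem _ h1 h2
      | add_right x y z _ _ _ h1 h2 => rw [mul_add]; exact Submodule.add_mem _ h1 h2
      | smul_left r x y _ _ h => rw [smul_mul_assoc]; exact Submodule.smul_mem _ _ h
      | smul_right r x y _ _ h => rw [mul_smul_comm]; exact Submodule.smul_mem _ _ h)

theorem diag_mem_half {d : Diagram (m + 1)} (hd : d.IsHalf) : diag n d ∈ half m n :=
  Submodule.subset_span ⟨d, hd, rfl⟩

/-- The basis vector of `ℂA_{m+1/2}(n)` given by a diagram in `A_{m+1/2}`. -/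
def diagHalf (n : ℂ) (d : Diagram (m + 1)) (hd : d.IsHalf) : half m n :=
  ⟨diag n d, diag_mem_half hd⟩

theorem half_hom_ext {M : Type} [AddCommGroup M] [Module ℂ M] {f g : half m n →ₗ[ℂ] M}
    (h : ∀ d hd, f (diagHalf n d hd) = g (diagHalf n d hd)) : f = g := by
  apply LinearMap.ext
  rintro ⟨x, hx⟩
  induction hx using Submodule.span_induction with
  | mem x hx =>
    obtain ⟨d, hd, rfl⟩ := hx
    exact h d hd
  | zero => exact (map_zero f).trans (map_zero g).symm
  | add x y hx hy h1 h2 =>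
    have := map_add f ⟨x, hx⟩ ⟨y, hy⟩
    rw [h1, h2, ← map_add] at this
    exact this
  | smul a x hx h1 =>
    have := map_smul f a ⟨x, hx⟩
    rw [h1, ← map_smul] at this
    exact this

/-! ### The inclusions -/

/-- The inclusion `ℂA_m(n) → ℂA_{m+1/2}(n)`: add a vertical strand. -/
def toHalf (m : ℕ) (n : ℂ) : PartitionAlgebra m n →ₐ[ℂ] half m n :=
  AlgHom.ofLinearMap (lift n fun d => diagHalf n d.addStrand d.isHalf_addStrand)
    (by
      rw [one_def, lift_diag]
      exact Subtype.ext (by rw [OneMemClass.coe_one, one_def, ← Diagram.addStrand_one]; rfl))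
    (by
      have h : ∀ L : PartitionAlgebra m n →ₗ[ℂ] half m n,
          (∀ d e, L (diag n d * diag n e) = L (diag n d) * L (diag n e)) →
            ∀ x y, L (x * y) = L x * L y := by
        intro L hL x y
        have : LinearMap.compr₂ (mulHom m n) L =
            (LinearMap.mul ℂ (half m n)).compl₁₂ L L :=
          hom_ext fun d => hom_ext fun e => hL d e
        exact LinearMap.congr_fun (LinearMap.congr_fun this x) y
      refine h _ fun d e => ?_
      rw [diag_mul_diag, map_smul, lift_diag, lift_diag, lift_diag]
      apply Subtype.ext
      change _ = diag n d.addStrand * diag n e.addStrand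
      rw [diag_mul_diag, (Diagram.addStrand_comp_aux d e).1, (Diagram.addStrand_comp_aux d e).2]
      rfl)

/-- The inclusion `ℂA_{m+1/2}(n) → ℂA_{m+1}(n)`. -/
def ofHalf (m : ℕ) (n : ℂ) : half m n →ₐ[ℂ] PartitionAlgebra (m + 1) n := (half m n).val

end PartitionAlgebra

/-! ## The basic construction -/

section Basic

variable {A B : Type} [Ring A] [Ring B] [Algebra ℂ A] [Algebra ℂ B]

/-- An `(A, A)`-bimodule homomorphism `ε : B → A`, where `A` acts on `B` through `ι : A → B`. -/
structure BimoduleMap (ι : A →ₐ[ℂ] B) where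
  /-- The underlying linear map. -/
  map : B →ₗ[ℂ] A
  map_left : ∀ a b, map (ι a * b) = a * map b
  map_right : ∀ b a, map (b * ι a) = map b * a

/-- The relations `b₁ a ⊗ b₂ = b₁ ⊗ a b₂` defining `B ⊗_A B` as a quotient of `B ⊗_ℂ B`. -/
def balancedRelations (ι : A →ₐ[ℂ] B) : Submodule ℂ (B ⊗[ℂ] B) :=
  Submodule.span ℂ {t | ∃ (b₁ : B) (a : A) (b₂ : B),
    t = (b₁ * ι a) ⊗ₜ[ℂ] b₂ - b₁ ⊗ₜ[ℂ] (ι a * b₂)}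

/-- The basic construction: the tensor product `B ⊗_A B`, with the product
`(b₁ ⊗ b₂) (b₃ ⊗ b₄) = b₁ ⊗ ε(b₂ b₃) b₄`. -/
def BasicConstruction {ι : A →ₐ[ℂ] B} (_ε : BimoduleMap ι) : Type :=
  (B ⊗[ℂ] B) ⧸ balancedRelations ι

namespace BasicConstruction

variable {ι : A →ₐ[ℂ] B} (ε : BimoduleMap ι)

instance : AddCommGroup (BasicConstruction ε) :=
  inferInstanceAs (AddCommGroup ((B ⊗[ℂ] B) ⧸ balancedRelations ι))

instance : Module ℂ (BasicConstruction ε) :=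
  inferInstanceAs (Module ℂ ((B ⊗[ℂ] B) ⧸ balancedRelations ι))

/-- The projection `B ⊗_ℂ B → B ⊗_A B`. -/
def proj : B ⊗[ℂ] B →ₗ[ℂ] BasicConstruction ε := (balancedRelations ι).mkQ

/-- The element `b₁ ⊗ b₂` of `B ⊗_A B`. -/
def tmul (b₁ b₂ : B) : BasicConstruction ε := proj ε (b₁ ⊗ₜ[ℂ] b₂)

theorem tmul_balanced (b₁ : B) (a : A) (b₂ : B) :
    tmul ε (b₁ * ι a) b₂ = tmul ε b₁ (ι a * b₂) :=
  (Submodule.Quotient.eq _).2 (Submodule.subset_span ⟨b₁, a, b₂, rfl⟩)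

theorem hom_ext {M : Type} [AddCommGroup M] [Module ℂ M] {f g : BasicConstruction ε →ₗ[ℂ] M}
    (h : ∀ b₁ b₂, f (tmul ε b₁ b₂) = g (tmul ε b₁ b₂)) : f = g :=
  Submodule.linearMap_qext _ (TensorProduct.ext' h)

/-- The linear map out of `B ⊗_A B` given by a balanced bilinear map. -/
def lift {M : Type} [AddCommGroup M] [Module ℂ M] (f : B →ₗ[ℂ] B →ₗ[ℂ] M)
    (hf : ∀ b₁ a b₂, f (b₁ * ι a) b₂ = f b₁ (ι a * b₂)) : BasicConstruction ε →ₗ[ℂ] M :=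
  (balancedRelations ι).liftQ (TensorProduct.lift f) (by
    refine Submodule.span_le.2 ?_
    rintro _ ⟨b₁, a, b₂, rfl⟩
    simp [hf])

@[simp]
theorem lift_tmul {M : Type} [AddCommGroup M] [Module ℂ M] (f : B →ₗ[ℂ] B →ₗ[ℂ] M)
    (hf : ∀ b₁ a b₂, f (b₁ * ι a) b₂ = f b₁ (ι a * b₂)) (b₁ b₂ : B) :
    lift ε f hf (tmul ε b₁ b₂) = f b₁ b₂ := rfl

/-- The bilinear map `(b₃, b₄) ↦ b₁ ⊗ ε(b₂ b₃) b₄`. -/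
def mulAux (b₁ b₂ : B) : B →ₗ[ℂ] B →ₗ[ℂ] BasicConstruction ε :=
  LinearMap.mk₂ ℂ (fun b₃ b₄ => tmul ε b₁ (ι (ε.map (b₂ * b₃)) * b₄))
    (by intros; simp [tmul, mul_add, add_mul, TensorProduct.tmul_add])
    (by intros; simp [tmul])
    (by intros; simp [tmul, mul_add, TensorProduct.tmul_add])
    (by intros; simp [tmul])

theorem mulAux_apply (b₁ b₂ b₃ b₄ : B) :
    mulAux ε b₁ b₂ b₃ b₄ = tmul ε b₁ (ι (ε.map (b₂ * b₃)) * b₄) := rfl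

theorem mulAux_balanced (b₁ b₂ b₃ : B) (a : A) (b₄ : B) :
    mulAux ε b₁ b₂ (b₃ * ι a) b₄ = mulAux ε b₁ b₂ b₃ (ι a * b₄) := by
  rw [mulAux_apply, mulAux_apply, ← mul_assoc, ε.map_right, map_mul, mul_assoc]

/-- The multiplication of the basic construction. -/
def mulHom : BasicConstruction ε →ₗ[ℂ] BasicConstruction ε →ₗ[ℂ] BasicConstruction ε :=
  lift ε
    (LinearMap.mk₂ ℂ (fun b₁ b₂ => lift ε (mulAux ε b₁ b₂) (mulAux_balanced ε b₁ b₂))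
      (fun b b' c => hom_ext ε fun b₃ b₄ => by
        change tmul ε (b + b') _ = tmul ε b _ + tmul ε b' _
        simp [tmul, TensorProduct.add_tmul])
      (fun r b c => hom_ext ε fun b₃ b₄ => by
        change tmul ε (r • b) _ = r • tmul ε b _
        rw [tmul, tmul, ← map_smul, TensorProduct.smul_tmul'])
      (fun b c c' => hom_ext ε fun b₃ b₄ => by
        change tmul ε b (ι (ε.map ((c + c') * b₃)) * b₄) =
          tmul ε b (ι (ε.map (c * b₃)) * b₄) + tmul ε b (ι (ε.map (c' * b₃)) * b₄)
        simp [tmul, add_mul, TensorProduct.tmul_add])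
      (fun r b c => hom_ext ε fun b₃ b₄ => by
        change tmul ε b (ι (ε.map ((r • c) * b₃)) * b₄) =
          r • tmul ε b (ι (ε.map (c * b₃)) * b₄)
        simp [tmul]))
    (fun b₁ a b₂ => hom_ext ε fun b₃ b₄ => by
      change tmul ε (b₁ * ι a) (ι (ε.map (b₂ * b₃)) * b₄) =
        tmul ε b₁ (ι (ε.map (ι a * b₂ * b₃)) * b₄)
      rw [tmul_balanced, mul_assoc (ι a), ε.map_left, map_mul ι, mul_assoc (ι a)])

instance : Mul (BasicConstruction ε) := ⟨fun x y => mulHom ε x y⟩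

theorem mul_def (x y : BasicConstruction ε) : x * y = mulHom ε x y := rfl

theorem tmul_mul_tmul (b₁ b₂ b₃ b₄ : B) :
    tmul ε b₁ b₂ * tmul ε b₃ b₄ = tmul ε b₁ (ι (ε.map (b₂ * b₃)) * b₄) := rfl

theorem mul_assoc_aux (x y z : BasicConstruction ε) : x * y * z = x * (y * z) := by
  have h : (LinearMap.compr₂ (mulHom ε) (mulHom ε)) =
      (LinearMap.llcomp ℂ _ _ _ ∘ₗ mulHom ε).compl₂ (mulHom ε) := by
    refine hom_ext ε fun b₁ b₂ => hom_ext ε fun b₃ b₄ => hom_ext ε fun b₅ b₆ => ?_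
    change tmul ε b₁ b₂ * tmul ε b₃ b₄ * tmul ε b₅ b₆ =
      tmul ε b₁ b₂ * (tmul ε b₃ b₄ * tmul ε b₅ b₆)
    simp only [tmul_mul_tmul, mul_assoc, ε.map_left, map_mul]
  exact LinearMap.congr_fun (LinearMap.congr_fun (LinearMap.congr_fun h x) y) z

instance : NonUnitalRing (BasicConstruction ε) :=
  { (inferInstance : AddCommGroup (BasicConstruction ε)) with
    mul := (· * ·)
    left_distrib := fun x y z => map_add (mulHom ε x) y z
    right_distrib := fun x y z => LinearMap.map_add₂ (mulHom ε) x y z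
    zero_mul := fun x => LinearMap.map_zero₂ (mulHom ε) x
    mul_zero := fun x => map_zero (mulHom ε x)
    mul_assoc := mul_assoc_aux ε }

instance : IsScalarTower ℂ (BasicConstruction ε) (BasicConstruction ε) :=
  ⟨fun r x y => LinearMap.map_smul₂ (mulHom ε) r x y⟩

instance : SMulCommClass ℂ (BasicConstruction ε) (BasicConstruction ε) :=
  ⟨fun r x y => (map_smul (mulHom ε x) r y).symm⟩

end BasicConstruction

end Basic

namespace PartitionAlgebra

open SetPartition

/-! ### The maps `ε` -/

/-- The linear map `ℂA_{m+1}(n) → ℂA_{m+1/2}(n)` that combines the blocks of `m+1` and `(m+1)'`. -/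
def mergeMap (m : ℕ) (n : ℂ) : PartitionAlgebra (m + 1) n →ₗ[ℂ] half m n :=
  lift n fun d => diagHalf n d.mergeLast d.isHalf_mergeLast

/-- The linear map that removes `m+1` and `(m+1)'` from a diagram, with a factor `n` for each block
that disappears. -/
def removeMap (m : ℕ) (n : ℂ) : PartitionAlgebra (m + 1) n →ₗ[ℂ] PartitionAlgebra m n :=
  lift n fun d => n ^ d.removedBlocks • diag n d.removeLast

/-- `ε_{1/2} : ℂA_{m+1}(n) → ℂA_{m+1/2}(n)`. -/
def epsMerge (m : ℕ) (n : ℂ) : BimoduleMap (ofHalf m n) where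
  map := mergeMap m n
  map_left := by
    have h : (LinearMap.mul ℂ (PartitionAlgebra (m + 1) n) ∘ₗ (ofHalf m n).toLinearMap).compr₂
        (mergeMap m n) = (LinearMap.mul ℂ (half m n)).compl₂ (mergeMap m n) := by
      refine half_hom_ext fun d hd => hom_ext fun e => ?_
      change mergeMap m n (diag n d * diag n e) = diagHalf n d hd * mergeMap m n (diag n e)
      rw [diag_mul_diag, map_smul, mergeMap, lift_diag, lift_diag]
      apply Subtype.ext
      change _ = diag n d * diag n e.mergeLast
      rw [diag_mul_diag, ← (Diagram.mergeLast_left_aux hd e).1,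
        ← (Diagram.mergeLast_left_aux hd e).2]
      rfl
    exact fun a b => LinearMap.congr_fun (LinearMap.congr_fun h a) b
  map_right := by
    have h : ((LinearMap.mul ℂ (PartitionAlgebra (m + 1) n)).compl₂
        (ofHalf m n).toLinearMap).compr₂ (mergeMap m n) =
          LinearMap.mul ℂ (half m n) ∘ₗ mergeMap m n := by
      refine hom_ext fun d => half_hom_ext fun e he => ?_
      change mergeMap m n (diag n d * diag n e) = mergeMap m n (diag n d) * diagHalf n e he
      rw [diag_mul_diag, map_smul, mergeMap, lift_diag, lift_diag]
      apply Subtype.ext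
      change _ = diag n d.mergeLast * diag n e
      rw [diag_mul_diag, ← (Diagram.mergeLast_right_aux d he).1,
        ← (Diagram.mergeLast_right_aux d he).2]
      rfl
    exact fun a b => LinearMap.congr_fun (LinearMap.congr_fun h a) b

/-- `ε^{1/2} : ℂA_{m+1/2}(n) → ℂA_m(n)`. -/
def epsRemove (m : ℕ) (n : ℂ) : BimoduleMap (toHalf m n) where
  map := removeMap m n ∘ₗ (half m n).val.toLinearMap
  map_left := by
    have h : (LinearMap.mul ℂ (half m n) ∘ₗ (toHalf m n).toLinearMap).compr₂
        (removeMap m n ∘ₗ (half m n).val.toLinearMap) =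
          (LinearMap.mul ℂ (PartitionAlgebra m n)).compl₂
            (removeMap m n ∘ₗ (half m n).val.toLinearMap) := by
      refine hom_ext fun d => half_hom_ext fun e he => ?_
      have hd : toHalf m n (diag n d) = diagHalf n d.addStrand d.isHalf_addStrand :=
        lift_diag _ _
      change removeMap m n ((toHalf m n (diag n d) : PartitionAlgebra (m + 1) n) * diag n e) =
        diag n d * removeMap m n (diag n e)
      rw [hd]
      change removeMap m n (diag n d.addStrand * diag n e) = _
      rw [diag_mul_diag, map_smul, removeMap, lift_diag, lift_diag, mul_smul_comm, diag_mul_diag,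
        smul_smul, smul_smul, ← pow_add, ← pow_add, (Diagram.removeLast_left_aux d e).1,
        (Diagram.removeLast_left_aux d e).2]
    exact fun a b => LinearMap.congr_fun (LinearMap.congr_fun h a) b
  map_right := by
    have h : ((LinearMap.mul ℂ (half m n)).compl₂ (toHalf m n).toLinearMap).compr₂
        (removeMap m n ∘ₗ (half m n).val.toLinearMap) =
          LinearMap.mul ℂ (PartitionAlgebra m n) ∘ₗ
            (removeMap m n ∘ₗ (half m n).val.toLinearMap) := by
      refine half_hom_ext fun d hd => hom_ext fun e => ?_
      have he : toHalf m n (diag n e) = diagHalf n e.addStrand e.isHalf_addStrand :=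
        lift_diag _ _
      change removeMap m n (diag n d * (toHalf m n (diag n e) : PartitionAlgebra (m + 1) n)) =
        removeMap m n (diag n d) * diag n e
      rw [he]
      change removeMap m n (diag n d * diag n e.addStrand) = _
      rw [diag_mul_diag, map_smul, removeMap, lift_diag, lift_diag, smul_mul_assoc, diag_mul_diag,
        smul_smul, smul_smul, ← pow_add, ← pow_add, (Diagram.removeLast_right_aux d e).1,
        (Diagram.removeLast_right_aux d e).2]
    exact fun a b => LinearMap.congr_fun (LinearMap.congr_fun h a) b

/-! ### The elements `p_k` and the spans `ℂI_k(n)` -/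

/-- `p_{m+1}` in `ℂA_{m+1}(n)`. -/
def pInt (m : ℕ) (n : ℂ) : PartitionAlgebra (m + 1) n := diag n (Diagram.p (Fin.last m))

/-- `p_{m+1+1/2}` in `ℂA_{m+1+1/2}(n)`: it joins the last two vertices of the rows of length
`m+2`. -/
def pHalf (m : ℕ) (n : ℂ) : half (m + 1) n :=
  diagHalf n (Diagram.pHalf (Fin.last m)) (Diagram.isHalf_pHalf _)

/-- `ℂI_m(n)`: the span of the diagrams in `A_m` of propagating number less than `m`. -/
def idealInt (m : ℕ) (n : ℂ) : Submodule ℂ (PartitionAlgebra m n) :=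
  Submodule.span ℂ {x | ∃ d : Diagram m, d.pn < m ∧ x = diag n d}

/-- `ℂI_{m+1/2}(n)`: the span of the diagrams in `A_{m+1/2}` of propagating number less than
`m+1/2`. -/
def idealHalf (m : ℕ) (n : ℂ) : Submodule ℂ (half m n) :=
  Submodule.span ℂ {x | ∃ (d : Diagram (m + 1)) (hd : d.IsHalf),
    (d.pn : ℚ) < m + 1 / 2 ∧ x = diagHalf n d hd}

end PartitionAlgebra

end

/-!
The heart of the matter is a general fact about the basic construction `B ⊗_A B` of a bimodule map
`ε : B → A`. Let `p` be an element of an algebra `P ⊇ B` that commutes with `A` and satisfies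
`p b p = ε(b) p` for `b ∈ B`; then `b₁ ⊗ b₂ ↦ b₁ p b₂` is a homomorphism of algebras. Here
`B = ℂA_{k-1/2}(n)`, `A = ℂA_{k-1}(n)` and `P = ℂA_k(n)`, and the bimodule map `ε_{k+1/2} : P → B`
sends `p_k` to `1`. So `p` can be cancelled in `b p = b' p`, and moreover `P p = B p` and
`p P = p B`.

For injectivity it is shown that each product `d₁ p d₂ = c d` of diagrams determines `d₁ ⊗ d₂` as
`c` times a canonical tensor of `d`. This rests on a regularity property: every diagram `d` with
`pn(d) < k` lies in `d P p P` and in `P p P d`. If `d = d w p v`, then `d w p = x p` and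
`p v = p y` with `x, y ∈ B`, and `x ⊗ y` is the canonical tensor; the property for `d₁ p` on the
other side moves everything across the tensor sign
(`BasicConstruction.injective_and_range_of_regular`). The argument never divides by `n`.

To see the regularity property, label the at most `k - 1` (or, for half-integers, `k - 1/2`)
propagating blocks of `d` by bottom vertices other than a fixed vertex `h`
(`Diagram.exists_labels`). Relabelling the bottom row of `d` and passing back restores `d`, once
the blocks of its bottom row are merged again, and the relabelling factors through `p_k`
(`PartitionAlgebra.exists_diag_mul_graph`). This needs a bottom vertex besides `h`, and fails for
`k = 1`, `n = 0`; for `k = 1` the algebras `A` and `B` are spanned by one diagram and the claim is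
direct.

Identities between products of diagrams are checked on matrices: a monomial `n ^ a d` is
determined by the matrix it has for `n = 2` in the action on two-colourings of the rows
(`PartitionAlgebra.HasMatrix.unique`).

For the quotient, `pn(d) < m` means that `d ∈ A_m` is not a permutation diagram
(`Diagram.pn_lt_iff`), and a composition `d ∘ e` is a permutation diagram only if `d` and `e` are.
So the linear map that kills the other diagrams is multiplicative.
-/

/-! ### Monomials and their matrices -/

namespace Diagram

open SetPartition

/-- The diagram with blocks `{j'} ∪ {i | θ i = j}` for the vertices `j`. -/
def graph {m : ℕ} (θ : Fin m → Fin m) : Diagram m := Setoid.ker (Sum.elim θ id)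

/-- The identity diagram with the blocks of `u` and `v` merged. -/
def tie {m : ℕ} (u v : Fin m) : Diagram m := one m ⊔ glue (Sum.inl u) (Sum.inl v)

/-- The identity diagram with vertices merged as in the bottom row of `d`. -/
def bottomMerge {m : ℕ} (d : Diagram m) : Diagram m := one m ⊔ (d.comap Sum.inr).map Sum.inr

/-- The mirror image of a diagram, with the two rows exchanged. -/
def mirror {m : ℕ} (d : Diagram m) : Diagram m := d.comap Sum.swap

end Diagram

namespace PartitionAlgebra

open SetPartition Diagram

variable {m : ℕ} {n : ℂ}

/-- The matrix of a diagram: its rows and columns are indexed by the two-colourings of the top and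
of the bottom row, and its entries tell which pairs of colourings are constant on blocks. -/
noncomputable def mat (d : Diagram m) : Matrix (Fin m → Bool) (Fin m → Bool) ℕ :=
  fun X Y => wt d (Sum.elim X Y)

/-- `x` is a monomial `n ^ a d`, and `M` is the matrix obtained by putting `2` for `n`. Such a
monomial is determined by its matrix, whatever `n` is. -/
def HasMatrix (x : PartitionAlgebra m n) (M : Matrix (Fin m → Bool) (Fin m → Bool) ℕ) : Prop :=
  ∃ (a : ℕ) (d : Diagram m), x = n ^ a • diag n d ∧ M = 2 ^ a • mat d

theorem hasMatrix_diag (d : Diagram m) : HasMatrix (diag n d) (mat d) :=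
  ⟨0, d, by simp, by simp⟩

theorem mat_mul_mat (d e : Diagram m) : mat d * mat e = 2 ^ loops d e • mat (comp d e) := by
  ext X Y
  simp only [Matrix.mul_apply, mat, Matrix.smul_apply, smul_eq_mul, sum_wt_mul_wt]

theorem HasMatrix.mul {x y : PartitionAlgebra m n} {M N} (hx : HasMatrix x M)
    (hy : HasMatrix y N) : HasMatrix (x * y) (M * N) := by
  obtain ⟨a, d, rfl, rfl⟩ := hx
  obtain ⟨b, e, rfl, rfl⟩ := hy
  refine ⟨a + b + loops d e, comp d e, ?_, ?_⟩
  · rw [smul_mul_smul_comm, diag_mul_diag, smul_smul, pow_add, pow_add]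
  · rw [smul_mul_smul_comm, mat_mul_mat, smul_smul, pow_add, pow_add]

theorem HasMatrix.unique {x y : PartitionAlgebra m n} {M} (hx : HasMatrix x M)
    (hy : HasMatrix y M) : x = y := by
  obtain ⟨a, d, rfl, rfl⟩ := hx
  obtain ⟨b, e, rfl, h⟩ := hy
  obtain ⟨rfl, rfl⟩ := scaled_ext (r := d) (s := e) (a := a) (b := b) fun c => by
    obtain ⟨X, Y, rfl⟩ := elim_surj c
    exact congrFun (congrFun h X) Y
  rfl

theorem HasMatrix.congr {x : PartitionAlgebra m n} {M N} (hx : HasMatrix x M) (h : M = N) :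
    HasMatrix x N := h ▸ hx

theorem mat_injective : Function.Injective (mat : Diagram m → _) := fun d e h =>
  (scaled_ext (r := d) (s := e) (a := 0) (b := 0) fun c => by
    obtain ⟨X, Y, rfl⟩ := elim_surj c
    simpa [mat] using congrFun (congrFun h X) Y).2

theorem mat_one : mat (one m) = 1 := by
  ext X Y
  rw [mat, wt_one, Matrix.one_apply]

theorem mat_graph (θ : Fin m → Fin m) (X Y : Fin m → Bool) :
    mat (graph θ) X Y = if X = Y ∘ θ then 1 else 0 := by
  classical
  rw [mat, graph, wt_ker]
  congr 1
  apply propext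
  constructor
  · intro h
    funext i
    exact h (Sum.inl i) (Sum.inr (θ i)) rfl
  · rintro rfl (a | a) (b | b) h <;> exact congrArg Y h

theorem mat_tie (u v : Fin m) (X Y : Fin m → Bool) :
    mat (tie u v) X Y = if X = Y ∧ X u = X v then 1 else 0 := by
  rw [mat, tie, wt_sup, wt_one, wt_glue]
  by_cases h1 : X = Y <;> by_cases h2 : X u = X v <;> simp [h1, h2]

theorem mat_bottomMerge (d : Diagram m) (X Y : Fin m → Bool) :
    mat (bottomMerge d) X Y = if X = Y then wt (d.comap Sum.inr) Y else 0 := by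
  rw [mat, bottomMerge, wt_sup, wt_one, wt_map, Sum.elim_comp_inr]
  split_ifs <;> simp

theorem mat_p (h : Fin m) (X Y : Fin m → Bool) :
    mat (Diagram.p h) X Y = if ∀ i, i ≠ h → X i = Y i then 1 else 0 := by
  classical
  rw [mat, Diagram.p, wt_ker]
  congr 1
  apply propext
  constructor
  · intro hh i hi
    exact hh (Sum.inl i) (Sum.inr i) (by simp [hi])
  · rintro hh (a | a) (b | b) hab <;> simp only [Sum.elim_inl, Sum.elim_inr, Prod.mk.injEq] at hab ⊢
    · rw [hab.1]
    · obtain ⟨rfl, hab⟩ := hab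
      exact hh a (by simpa using hab)
    · obtain ⟨rfl, hab⟩ := hab
      exact (hh a (by simpa using hab.symm)).symm
    · rw [hab.1]

theorem mat_mirror (d : Diagram m) : mat (mirror d) = (mat d).transpose := by
  have key : ∀ (d : Diagram m) (X Y : Fin m → Bool), d ≤ Setoid.ker (Sum.elim Y X) →
      d.mirror ≤ Setoid.ker (Sum.elim X Y) := by
    intro d X Y h a b hab
    have := h hab
    cases a <;> cases b <;> exact this
  ext X Y
  simp only [mat, Matrix.transpose_apply, wt]
  congr 1
  apply propext
  refine ⟨fun h => ?_, key d X Y⟩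
  have h2 := key (mirror d) Y X h
  have : mirror (mirror d) = d := by
    ext a b
    cases a <;> cases b <;> rfl
  rwa [this] at h2

theorem mirror_mirror (d : Diagram m) : mirror (mirror d) = d :=
  mat_injective (by rw [mat_mirror, mat_mirror, Matrix.transpose_transpose])

theorem mirror_comp_aux (d e : Diagram m) :
    loops d e = loops (mirror e) (mirror d) ∧ mirror (comp d e) = comp (mirror e) (mirror d) := by
  refine scaled_ext fun c => ?_
  obtain ⟨X, Y, rfl⟩ := elim_surj c
  have h := congrArg Matrix.transpose (mat_mul_mat d e)
  rw [Matrix.transpose_mul, ← mat_mirror, ← mat_mirror, mat_mul_mat, Matrix.transpose_smul,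
    ← mat_mirror] at h
  exact (congrFun (congrFun h X) Y).symm

/-- The linear map reflecting every diagram. -/
noncomputable def mirrorMap (m : ℕ) (n : ℂ) : PartitionAlgebra m n →ₗ[ℂ] PartitionAlgebra m n :=
  lift n fun d => diag n (mirror d)

theorem mirrorMap_diag (d : Diagram m) : mirrorMap m n (diag n d) = diag n (mirror d) := lift_diag _ _

theorem mirrorMap_mul (x y : PartitionAlgebra m n) :
    mirrorMap m n (x * y) = mirrorMap m n y * mirrorMap m n x := by
  have h : (LinearMap.mul ℂ (PartitionAlgebra m n)).compr₂ (mirrorMap m n) =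
      ((LinearMap.mul ℂ (PartitionAlgebra m n)).compl₁₂ (mirrorMap m n) (mirrorMap m n)).flip := by
    refine hom_ext fun d => hom_ext fun e => ?_
    change mirrorMap m n (diag n d * diag n e) = mirrorMap m n (diag n e) * mirrorMap m n (diag n d)
    rw [diag_mul_diag, map_smul, mirrorMap_diag, mirrorMap_diag, mirrorMap_diag, diag_mul_diag,
      (mirror_comp_aux d e).1, (mirror_comp_aux d e).2]
  exact LinearMap.congr_fun (LinearMap.congr_fun h x) y

theorem mirror_p (h : Fin m) : mirror (Diagram.p h) = Diagram.p h := by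
  apply mat_injective
  rw [mat_mirror]
  ext X Y
  simp only [Matrix.transpose_apply, mat_p, eq_comm]

/-! ### Matrices and the maps between partition algebras -/

theorem matrix_ext_snoc {M N : Matrix (Fin (m + 1) → Bool) (Fin (m + 1) → Bool) ℕ}
    (h : ∀ x s y t, M (Fin.snoc x s) (Fin.snoc y t) = N (Fin.snoc x s) (Fin.snoc y t)) :
    M = N := by
  ext X Y
  obtain ⟨x, s, rfl⟩ := snoc_surj X
  obtain ⟨y, t, rfl⟩ := snoc_surj Y
  exact h x s y t

/-- The effect of `toHalf` on matrices. -/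
def strandMatrix (M : Matrix (Fin m → Bool) (Fin m → Bool) ℕ) :
    Matrix (Fin (m + 1) → Bool) (Fin (m + 1) → Bool) ℕ :=
  fun X Y => if X (Fin.last m) = Y (Fin.last m) then M (Fin.init X) (Fin.init Y) else 0

/-- The effect of `mergeMap` on matrices. -/
def mergeMatrix (M : Matrix (Fin (m + 1) → Bool) (Fin (m + 1) → Bool) ℕ) :
    Matrix (Fin (m + 1) → Bool) (Fin (m + 1) → Bool) ℕ :=
  fun X Y => if X (Fin.last m) = Y (Fin.last m) then M X Y else 0

/-- The effect of `removeMap` on matrices. -/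
def removeMatrix (M : Matrix (Fin (m + 1) → Bool) (Fin (m + 1) → Bool) ℕ) :
    Matrix (Fin m → Bool) (Fin m → Bool) ℕ :=
  fun x y => ∑ s : Bool, ∑ t : Bool, M (Fin.snoc x s) (Fin.snoc y t)

@[simp]
theorem strandMatrix_snoc (M : Matrix (Fin m → Bool) (Fin m → Bool) ℕ) (x s y t) :
    strandMatrix M (Fin.snoc x s) (Fin.snoc y t) = if s = t then M x y else 0 := by
  simp [strandMatrix]

@[simp]
theorem mergeMatrix_snoc (M : Matrix (Fin (m + 1) → Bool) (Fin (m + 1) → Bool) ℕ)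
    (x : Fin m → Bool) (s : Bool) (y : Fin m → Bool) (t : Bool) :
    mergeMatrix M (Fin.snoc x s) (Fin.snoc y t) =
      if s = t then M (Fin.snoc x s) (Fin.snoc y t) else 0 := by
  simp [mergeMatrix]

theorem toHalf_diag (d : Diagram m) :
    toHalf m n (diag n d) = diagHalf n d.addStrand d.isHalf_addStrand := lift_diag _ _

theorem HasMatrix.toHalf {x : PartitionAlgebra m n} {M} (hx : HasMatrix x M) :
    HasMatrix (toHalf m n x : PartitionAlgebra (m + 1) n) (strandMatrix M) := by
  obtain ⟨a, d, rfl, rfl⟩ := hx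
  refine ⟨a, d.addStrand, ?_, matrix_ext_snoc fun x s y t => ?_⟩
  · rw [map_smul, toHalf_diag]
    rfl
  · simp only [strandMatrix_snoc, Matrix.smul_apply, smul_eq_mul, mat, wt_addStrand, mul_ite,
      mul_zero]

theorem HasMatrix.mergeMap {x : PartitionAlgebra (m + 1) n} {M} (hx : HasMatrix x M) :
    HasMatrix (mergeMap m n x : PartitionAlgebra (m + 1) n) (mergeMatrix M) := by
  obtain ⟨a, d, rfl, rfl⟩ := hx
  refine ⟨a, d.mergeLast, ?_, matrix_ext_snoc fun x s y t => ?_⟩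
  · rw [map_smul, PartitionAlgebra.mergeMap, lift_diag]
    rfl
  · simp only [mergeMatrix_snoc, Matrix.smul_apply, smul_eq_mul, mat, wt_mergeLast, mul_ite,
      mul_zero]

theorem HasMatrix.removeMap {x : PartitionAlgebra (m + 1) n} {M} (hx : HasMatrix x M) :
    HasMatrix (removeMap m n x) (removeMatrix M) := by
  obtain ⟨a, d, rfl, rfl⟩ := hx
  refine ⟨a + d.removedBlocks, d.removeLast, ?_, ?_⟩
  · rw [map_smul, PartitionAlgebra.removeMap, lift_diag, smul_smul, pow_add]
  · ext x y
    simp only [removeMatrix, Matrix.smul_apply, smul_eq_mul, ← Finset.mul_sum, mat,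
      sum_wt_removeLast, pow_add, mul_assoc]

theorem mat_p_last (x s y t) :
    mat (Diagram.p (Fin.last m)) (Fin.snoc x s) (Fin.snoc y t) = if x = y then 1 else 0 := by
  rw [mat_p]
  congr 1
  apply propext
  constructor
  · intro h
    funext i
    simpa using h i.castSucc (Fin.castSucc_lt_last i).ne
  · rintro rfl i hi
    obtain ⟨i, rfl⟩ := Fin.exists_castSucc_eq.2 hi
    simp

theorem pHalf_eq_tie (i : Fin m) : Diagram.pHalf i = tie i.succ i.castSucc := by
  classical
  apply mat_injective
  ext X Y
  rw [mat_tie, mat, Diagram.pHalf, wt_ker]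
  congr 1
  apply propext
  constructor
  · intro h
    have h1 : ∀ a b : Fin (m + 1), (if a = i.succ then i.castSucc else a) =
        (if b = i.succ then i.castSucc else b) → X a = Y b := fun a b => h (Sum.inl a) (Sum.inr b)
    have hi : i.castSucc ≠ i.succ := (Fin.castSucc_lt_succ).ne
    refine ⟨funext fun a => h1 a a rfl, ?_⟩
    exact h (Sum.inl i.succ) (Sum.inl i.castSucc) (by simp [hi])
  · rintro ⟨rfl, h⟩
    have h1 : ∀ a : Fin (m + 1), X a = X (if a = i.succ then i.castSucc else a) := by
      intro a
      split_ifs with ha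
      · rw [ha, h]
      · rfl
    have h2 : ∀ a b : Fin (m + 1), (if a = i.succ then i.castSucc else a) =
        (if b = i.succ then i.castSucc else b) → X a = X b := fun a b hab => by
      rw [h1 a, h1 b, hab]
    rintro (a | a) (b | b) hab <;> exact h2 a b hab

theorem mat_pHalf_last (x : Fin m → Bool) (a a' : Bool) (y : Fin m → Bool) (b b' : Bool) :
    mat (Diagram.pHalf (Fin.last m))
      (Fin.snoc (Fin.snoc x a : Fin (m + 1) → Bool) a' : Fin (m + 2) → Bool)
      (Fin.snoc (Fin.snoc y b : Fin (m + 1) → Bool) b') =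
      if x = y ∧ a = b ∧ a' = b' ∧ a' = a then 1 else 0 := by
  rw [pHalf_eq_tie, mat_tie]
  congr 1
  apply propext
  simp [Fin.snoc_inj, and_assoc, Fin.succ_last]

end PartitionAlgebra

namespace PartitionAlgebra

open SetPartition Diagram

variable {m : ℕ} {n : ℂ}

/-! ### The relations between `p_k` and the bimodule maps -/

theorem induction_on {motive : PartitionAlgebra m n → Prop} (x : PartitionAlgebra m n)
    (diag : ∀ d, motive (diag n d)) (add : ∀ x y, motive x → motive y → motive (x + y))
    (smul : ∀ (c : ℂ) x, motive x → motive (c • x)) : motive x := by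
  refine Finsupp.induction_linear (motive := motive) x ?_ add fun d c => ?_
  · have := smul 0 _ (diag ⊤)
    rwa [zero_smul] at this
  · rw [show (Finsupp.single d c : PartitionAlgebra m n) = c • PartitionAlgebra.diag n d from
      (Finsupp.smul_single_one d c).symm]
    exact smul c _ (diag d)

theorem half_induction_on {motive : half m n → Prop} (x : half m n)
    (diag : ∀ d hd, motive (diagHalf n d hd)) (add : ∀ x y, motive x → motive y → motive (x + y))
    (smul : ∀ (c : ℂ) x, motive x → motive (c • x)) : motive x := by
  obtain ⟨x, hx⟩ := x
  induction hx using Submodule.span_induction with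
  | mem x hx =>
    obtain ⟨d, hd, rfl⟩ := hx
    exact diag d hd
  | zero =>
    have := smul 0 _ (diag (one (m + 1)) isHalf_one)
    rwa [zero_smul] at this
  | add x y hx hy h1 h2 => exact add ⟨x, hx⟩ ⟨y, hy⟩ h1 h2
  | smul a x hx h1 => exact smul a ⟨x, hx⟩ h1

theorem span_diag : Submodule.span ℂ (Set.range (diag n : Diagram m → _)) = ⊤ := by
  refine Submodule.eq_top_iff'.2 fun x => ?_
  induction x using induction_on with
  | diag d => exact Submodule.subset_span ⟨d, rfl⟩
  | add x y hx hy => exact Submodule.add_mem _ hx hy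
  | smul c x hx => exact Submodule.smul_mem _ c hx

theorem span_diagHalf :
    Submodule.span ℂ {x : half m n | ∃ d hd, x = diagHalf n d hd} = ⊤ := by
  refine Submodule.eq_top_iff'.2 fun x => ?_
  induction x using half_induction_on with
  | diag d hd => exact Submodule.subset_span ⟨d, hd, rfl⟩
  | add x y hx hy => exact Submodule.add_mem _ hx hy
  | smul c x hx => exact Submodule.smul_mem _ c hx

theorem mat_eq_zero_of_isHalf {d : Diagram (m + 1)} (hd : d.IsHalf) (x y : Fin m → Bool)
    {s t : Bool} (h : s ≠ t) : mat d (Fin.snoc x s) (Fin.snoc y t) = 0 :=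
  hd.wt_eq_zero x y h

theorem hasMatrix_pInt : HasMatrix (pInt m n) (mat (Diagram.p (Fin.last m))) := hasMatrix_diag _

theorem hasMatrix_pHalf : HasMatrix (pHalf m n : PartitionAlgebra (m + 2) n)
    (mat (Diagram.pHalf (Fin.last m))) := hasMatrix_diag _

theorem pInt_mul_toHalf (a : PartitionAlgebra m n) :
    pInt m n * (toHalf m n a : PartitionAlgebra (m + 1) n) = toHalf m n a * pInt m n := by
  induction a using induction_on with
  | diag d =>
    have hd := (hasMatrix_diag (n := n) d).toHalf
    refine (hasMatrix_pInt.mul hd).unique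
      ((hd.mul hasMatrix_pInt).congr (matrix_ext_snoc fun x s y t => ?_))
    simp [Matrix.mul_apply, sum_snoc, mat_p_last]
  | add x y hx hy => simp only [map_add, Subalgebra.coe_add, mul_add, add_mul, hx, hy]
  | smul c x hx => simp only [map_smul, Subalgebra.coe_smul, mul_smul_comm, smul_mul_assoc, hx]

theorem pInt_mul_mul_pInt (b : half m n) :
    pInt m n * b * pInt m n = toHalf m n ((epsRemove m n).map b) * pInt m n := by
  induction b using half_induction_on with
  | diag d hd =>
    have h := hasMatrix_diag (n := n) d
    refine ((hasMatrix_pInt.mul h).mul hasMatrix_pInt).unique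
      ((h.removeMap.toHalf.mul hasMatrix_pInt).congr (matrix_ext_snoc fun x s y t => ?_))
    simp [Matrix.mul_apply, sum_snoc, mat_p_last, removeMatrix]
    ring
  | add x y hx hy => simp only [map_add, Subalgebra.coe_add, mul_add, add_mul, hx, hy]
  | smul c x hx => simp only [map_smul, Subalgebra.coe_smul, mul_smul_comm, smul_mul_assoc, hx]

theorem epsMerge_pInt : (epsMerge m n).map (pInt m n) = 1 := by
  refine Subtype.ext (hasMatrix_pInt.mergeMap.unique ?_)
  refine (hasMatrix_diag (one (m + 1))).congr (matrix_ext_snoc fun x s y t => ?_)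
  rw [mat_one, Matrix.one_apply, mergeMatrix_snoc, mat_p_last]
  simp [Fin.snoc_inj, ite_and, and_comm]

theorem mul_pInt (a : PartitionAlgebra (m + 1) n) :
    a * pInt m n = (epsMerge m n).map (a * pInt m n) * pInt m n := by
  induction a using induction_on with
  | diag d =>
    have h := (hasMatrix_diag (n := n) d).mul hasMatrix_pInt
    refine h.unique ((h.mergeMap.mul hasMatrix_pInt).congr (matrix_ext_snoc fun x s y t => ?_))
    simp [Matrix.mul_apply, sum_snoc, mat_p_last, mergeMatrix_snoc]
  | add x y hx hy =>
    simp only [add_mul, map_add, Subalgebra.coe_add]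
    rw [← hx, ← hy]
  | smul c x hx =>
    simp only [map_smul, Subalgebra.coe_smul, smul_mul_assoc]
    rw [← hx]

theorem pInt_mul (a : PartitionAlgebra (m + 1) n) :
    pInt m n * a = pInt m n * (epsMerge m n).map (pInt m n * a) := by
  induction a using induction_on with
  | diag d =>
    have h := hasMatrix_pInt.mul (hasMatrix_diag (n := n) d)
    refine h.unique ((hasMatrix_pInt.mul h.mergeMap).congr (matrix_ext_snoc fun x s y t => ?_))
    simp [Matrix.mul_apply, sum_snoc, mat_p_last, mergeMatrix_snoc]
  | add x y hx hy =>
    simp only [mul_add, map_add, Subalgebra.coe_add]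
    rw [← hx, ← hy]
  | smul c x hx =>
    simp only [map_smul, Subalgebra.coe_smul, mul_smul_comm]
    rw [← hx]

theorem pHalf_mul_toHalf (a : half m n) :
    pHalf m n * toHalf (m + 1) n a = toHalf (m + 1) n a * pHalf m n := by
  induction a using half_induction_on with
  | diag d hd =>
    have h := (hasMatrix_diag (n := n) d).toHalf
    refine Subtype.ext ((hasMatrix_pHalf.mul h).unique
      ((h.mul hasMatrix_pHalf).congr (matrix_ext_snoc fun x s y t => ?_)))
    obtain ⟨x, s', rfl⟩ := snoc_surj x
    obtain ⟨y, t', rfl⟩ := snoc_surj y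
    simp only [Matrix.mul_apply, sum_snoc, strandMatrix_snoc, mat_pHalf_last, Fintype.sum_bool]
    cases s <;> cases s' <;> cases t <;> cases t' <;> simp [mat_eq_zero_of_isHalf hd]
  | add x y hx hy => simp only [map_add, Subalgebra.coe_add, mul_add, add_mul, hx, hy]
  | smul c x hx => simp only [map_smul, Subalgebra.coe_smul, mul_smul_comm, smul_mul_assoc, hx]

theorem pHalf_mul_mul_pHalf (b : PartitionAlgebra (m + 1) n) :
    pHalf m n * toHalf (m + 1) n b * pHalf m n =
      toHalf (m + 1) n ((epsMerge m n).map b) * pHalf m n := by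
  induction b using induction_on with
  | diag d =>
    have h := hasMatrix_diag (n := n) d
    refine Subtype.ext (((hasMatrix_pHalf.mul h.toHalf).mul hasMatrix_pHalf).unique
      ((h.mergeMap.toHalf.mul hasMatrix_pHalf).congr (matrix_ext_snoc fun x s y t => ?_)))
    obtain ⟨x, s', rfl⟩ := snoc_surj x
    obtain ⟨y, t', rfl⟩ := snoc_surj y
    simp only [Matrix.mul_apply, sum_snoc, strandMatrix_snoc, mat_pHalf_last, mergeMatrix_snoc,
      Fintype.sum_bool]
    cases s <;> cases s' <;> cases t <;> cases t' <;> simp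
  | add x y hx hy => simp only [map_add, Subalgebra.coe_add, mul_add, add_mul, hx, hy]
  | smul c x hx => simp only [map_smul, Subalgebra.coe_smul, mul_smul_comm, smul_mul_assoc, hx]

theorem epsRemove_pHalf : (epsRemove (m + 1) n).map (pHalf m n) = 1 := by
  refine hasMatrix_pHalf.removeMap.unique ?_
  refine (hasMatrix_diag (one (m + 1))).congr (matrix_ext_snoc fun x s y t => ?_)
  rw [mat_one, Matrix.one_apply]
  simp only [removeMatrix, mat_pHalf_last, Fin.snoc_inj, Fintype.sum_bool]
  cases s <;> cases t <;> simp

theorem mul_pHalf (a : half (m + 1) n) :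
    a * pHalf m n = toHalf (m + 1) n ((epsRemove (m + 1) n).map (a * pHalf m n)) * pHalf m n := by
  induction a using half_induction_on with
  | diag d hd =>
    have h := (hasMatrix_diag (n := n) d).mul (hasMatrix_pHalf (m := m))
    refine Subtype.ext (h.unique ((h.removeMap.toHalf.mul hasMatrix_pHalf).congr
      (matrix_ext_snoc fun x s y t => ?_)))
    obtain ⟨x, s', rfl⟩ := snoc_surj x
    obtain ⟨y, t', rfl⟩ := snoc_surj y
    simp only [Matrix.mul_apply, sum_snoc, strandMatrix_snoc, mat_pHalf_last, removeMatrix,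
      Fintype.sum_bool]
    cases s <;> cases t <;> cases t' <;> simp [mat_eq_zero_of_isHalf hd]
  | add x y hx hy =>
    simp only [add_mul, map_add]
    rw [← hx, ← hy]
  | smul c x hx =>
    simp only [map_smul, smul_mul_assoc]
    rw [← hx]

theorem pHalf_mul (a : half (m + 1) n) :
    pHalf m n * a = pHalf m n * toHalf (m + 1) n ((epsRemove (m + 1) n).map (pHalf m n * a)) := by
  induction a using half_induction_on with
  | diag d hd =>
    have h := (hasMatrix_pHalf (m := m)).mul (hasMatrix_diag (n := n) d)
    refine Subtype.ext (h.unique ((hasMatrix_pHalf.mul h.removeMap.toHalf).congr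
      (matrix_ext_snoc fun x s y t => ?_)))
    obtain ⟨x, s', rfl⟩ := snoc_surj x
    obtain ⟨y, t', rfl⟩ := snoc_surj y
    simp only [Matrix.mul_apply, sum_snoc, strandMatrix_snoc, mat_pHalf_last, removeMatrix,
      Fintype.sum_bool]
    cases s <;> cases t <;> cases s' <;> simp [mat_eq_zero_of_isHalf hd]
  | add x y hx hy =>
    simp only [mul_add, map_add]
    rw [← hx, ← hy]
  | smul c x hx =>
    simp only [map_smul, mul_smul_comm]
    rw [← hx]

end PartitionAlgebra

/-! ### Propagating numbers and permutation diagrams -/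

namespace Diagram

open SetPartition PartitionAlgebra

variable {m : ℕ}

theorem exists_eq_ofPerm {d : Diagram m} (h₁ : ∀ i i', d (Sum.inl i) (Sum.inl i') → i = i')
    (h₂ : ∀ i, ∃ j, d (Sum.inl i) (Sum.inr j)) : ∃ σ, d = ofPerm σ := by
  choose f hf using h₂
  have hinj : Function.Injective f := fun i i' h =>
    h₁ _ _ (d.trans (hf i) (h ▸ d.symm (hf i')))
  let τ := Equiv.ofBijective f (Finite.injective_iff_bijective.1 hinj)
  have hτ : ∀ u, d (Sum.inl (Sum.elim id τ.symm u)) u := by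
    rintro (i | j)
    · exact d.refl _
    · have := hf (τ.symm j)
      rwa [show f (τ.symm j) = j from τ.apply_symm_apply j] at this
  refine ⟨τ.symm, Setoid.ext fun u v => ⟨fun h => ?_, fun h => ?_⟩⟩
  · exact h₁ _ _ (d.trans (hτ u) (d.trans h (d.symm (hτ v))))
  · have h' : Sum.elim id τ.symm u = Sum.elim id τ.symm v := h
    exact d.trans (d.symm (hτ u)) (h' ▸ hτ v)

/-- The diagrams of maximal propagating number are the permutation diagrams. -/
theorem pn_lt_iff {d : Diagram m} : d.pn < m ↔ ¬ ∃ σ, d = ofPerm σ := by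
  rw [← not_le, not_iff_not]
  constructor
  · intro h
    choose s hs using fun q : {q : Quotient d // (∃ i, Quotient.mk d (Sum.inl i) = q) ∧
      ∃ j, Quotient.mk d (Sum.inr j) = q} => q.2.1
    have hinj : Function.Injective s := fun q q' hq => Subtype.ext (by rw [← hs q, ← hs q', hq])
    have hsurj : Function.Surjective s :=
      (hinj.bijective_of_nat_card_le (by rwa [Nat.card_fin])).2
    apply exists_eq_ofPerm
    · intro i i' hi
      obtain ⟨q, rfl⟩ := hsurj i
      obtain ⟨q', rfl⟩ := hsurj i'
      exact congrArg s (Subtype.ext (by rw [← hs q, ← hs q']; exact Quotient.sound hi))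
    · intro i
      obtain ⟨q, rfl⟩ := hsurj i
      obtain ⟨j, hj⟩ := q.2.2
      exact ⟨j, Quotient.exact ((hs q).trans hj.symm)⟩
  · rintro ⟨σ, rfl⟩
    have h : Nat.card (Fin m) ≤ (ofPerm σ).pn := by
      refine Nat.card_le_card_of_injective
        (fun i => ⟨Quotient.mk _ (Sum.inl i), ⟨i, rfl⟩, σ.symm i, Quotient.sound ?_⟩) ?_
      · exact σ.apply_symm_apply i
      · intro i i' h
        exact Quotient.exact (congrArg Subtype.val h)
    rwa [Nat.card_fin] at h

theorem mirror_ofPerm (σ : Equiv.Perm (Fin m)) : (ofPerm σ).mirror = ofPerm σ⁻¹ := by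
  ext u v
  change Sum.elim (fun i => i) (fun j => σ j) u.swap = Sum.elim (fun i => i) (fun j => σ j) v.swap ↔
    Sum.elim (fun i => i) (fun j => σ⁻¹ j) u = Sum.elim (fun i => i) (fun j => σ⁻¹ j) v
  cases u <;> cases v <;> simp [Equiv.eq_symm_apply, Equiv.symm_apply_eq]

theorem pn_mirror_lt {d : Diagram m} (h : d.pn < m) : d.mirror.pn < m := by
  rw [pn_lt_iff] at h ⊢
  rintro ⟨σ, hσ⟩
  exact h ⟨σ⁻¹, by rw [← mirror_ofPerm, ← hσ, mirror_mirror]⟩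

theorem IsHalf.mirror {d : Diagram (m + 1)} (h : d.IsHalf) : d.mirror.IsHalf := d.symm h

/-- In a factorisation of a permutation diagram every top vertex of the upper factor is connected
to the bottom row, for otherwise its component in the stack would not reach the bottom. -/
theorem left_of_comp_eq_ofPerm {d e : Diagram m} {σ : Equiv.Perm (Fin m)}
    (h : comp d e = ofPerm σ) : ∃ τ, d = ofPerm τ := by
  classical
  have h₁ : ∀ i i', d (Sum.inl i) (Sum.inl i') → i = i' := fun i i' hi => by
    have : comp d e (Sum.inl i) (Sum.inl i') :=
      (le_sup_left : _ ≤ stack d e) (Relation.EqvGen.rel _ _ ⟨_, _, hi, rfl, rfl⟩)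
    rw [h] at this
    exact this
  refine exists_eq_ofPerm h₁ fun i => ?_
  by_contra! hi
  let c : Fin m ⊕ (Fin m ⊕ Fin m) → Prop := fun u => u = Sum.inl i
  have hc : stack d e ≤ Setoid.ker c := by
    refine sup_le (Setoid.eqvGen_le ?_) (Setoid.eqvGen_le ?_)
    · rintro _ _ ⟨u, v, huv, rfl, rfl⟩
      rcases u with u | u <;> rcases v with v | v
      · rw [h₁ _ _ huv]
      · refine propext ⟨fun hu => ?_, fun hv => ?_⟩
        · cases hu
          exact absurd huv (hi v)
        · cases hv
      · refine propext ⟨fun hu => ?_, fun hv => ?_⟩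
        · cases hu
        · cases hv
          exact absurd (d.symm huv) (hi u)
      · exact propext ⟨fun hu => (nomatch hu), fun hu => (nomatch hu)⟩
    · rintro _ _ ⟨u, v, huv, rfl, rfl⟩
      exact propext ⟨fun hu => (nomatch hu), fun hu => (nomatch hu)⟩
  have hr : comp d e (Sum.inl i) (Sum.inr (σ.symm i)) := by
    rw [h]
    exact (σ.apply_symm_apply i).symm
  have := hc hr
  have h' : c (Sum.inl i) = c (Sum.inr (Sum.inr (σ.symm i))) := this
  exact (nomatch (h' ▸ (rfl : c (Sum.inl i)) : c (Sum.inr (Sum.inr (σ.symm i)))))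

theorem right_of_comp_eq_ofPerm {d e : Diagram m} {σ : Equiv.Perm (Fin m)}
    (h : comp d e = ofPerm σ) : ∃ τ, e = ofPerm τ := by
  have h' := congrArg mirror h
  rw [(mirror_comp_aux d e).2, mirror_ofPerm] at h'
  obtain ⟨τ, hτ⟩ := left_of_comp_eq_ofPerm h'
  exact ⟨τ⁻¹, by rw [← mirror_ofPerm, ← hτ, mirror_mirror]⟩

theorem pn_comp_lt_left {d e : Diagram m} (h : d.pn < m) : pn (comp d e : Diagram m) < m := by
  rw [pn_lt_iff] at h ⊢
  exact fun ⟨_, hσ⟩ => h (left_of_comp_eq_ofPerm hσ)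

theorem pn_comp_lt_right {d e : Diagram m} (h : e.pn < m) : pn (comp d e : Diagram m) < m := by
  rw [pn_lt_iff] at h ⊢
  exact fun ⟨_, hσ⟩ => h (right_of_comp_eq_ofPerm hσ)

theorem pn_p_lt (j : Fin m) : pn (Diagram.p j) < m := by
  rw [pn_lt_iff]
  rintro ⟨σ, h⟩
  have : Diagram.p j (Sum.inl j) (Sum.inr (σ.symm j)) := by
    rw [h]
    exact (σ.apply_symm_apply j).symm
  have h2 : ((j, decide (j = j)) : Fin m × Bool) = (σ.symm j, false) := this
  simp at h2

theorem pn_pHalf_lt (i : Fin m) : pn (Diagram.pHalf i) < m + 1 := by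
  rw [pn_lt_iff]
  rintro ⟨σ, h⟩
  have : Diagram.pHalf i (Sum.inl i.succ) (Sum.inl i.castSucc) := by
    rw [pHalf_eq_tie]
    exact (le_sup_right : _ ≤ tie i.succ i.castSucc) (Relation.EqvGen.rel _ _ ⟨rfl, rfl⟩)
  rw [h] at this
  have h2 : i.succ = i.castSucc := this
  exact absurd h2 (Fin.castSucc_lt_succ).ne'

/-- Every propagating block of `d` can be given its own label different from `h`, and each label
can be sent back to a bottom vertex of its block; `β` and `α` are these maps on bottom vertices. The
block of `c`, if it propagates, may be labelled by `c` itself. -/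
theorem exists_labels (d : Diagram (m + 1)) (hd : d.pn < m + 1) {h c : Fin (m + 1)} (hc : c ≠ h) :
    ∃ α β : Fin (m + 1) → Fin (m + 1),
      (∀ z z', d (Sum.inr z) (Sum.inr z') → β z = β z') ∧
      (∀ x z, d (Sum.inl x) (Sum.inr z) → d (Sum.inr (α (β z))) (Sum.inr z)) ∧
      (∀ z, β z ≠ h) ∧ ∀ x, d (Sum.inl x) (Sum.inr c) → β c = c ∧ α c = c := by
  classical
  let T := {q : Quotient d // (∃ i, Quotient.mk d (Sum.inl i) = q) ∧
    ∃ j, Quotient.mk d (Sum.inr j) = q}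
  let U := {y : Fin (m + 1) // y ≠ h}
  have : Fintype T := Fintype.ofFinite T
  have hTU : Fintype.card T ≤ Fintype.card U := by
    have : Fintype.card T = d.pn := Nat.card_eq_fintype_card.symm
    have : Fintype.card U = m := by simp [U]
    omega
  obtain ⟨κ₀⟩ := Function.Embedding.nonempty_of_card_le hTU
  let t : (∃ x, d (Sum.inl x) (Sum.inr c)) → T := fun hx =>
    ⟨Quotient.mk d (Sum.inr c), hx.imp fun _ hx => Quotient.sound hx, c, rfl⟩
  obtain ⟨κ, hκ⟩ : ∃ κ : T ↪ U, ∀ hx, κ (t hx) = ⟨c, hc⟩ := by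
    by_cases hx : ∃ x, d (Sum.inl x) (Sum.inr c)
    · exact ⟨κ₀.trans (Equiv.swap (κ₀ (t hx)) ⟨c, hc⟩).toEmbedding, fun _ => by simp⟩
    · exact ⟨κ₀, fun h => absurd h hx⟩
  let β : Fin (m + 1) → Fin (m + 1) := fun z =>
    if hz : ∃ i, Quotient.mk d (Sum.inl i) = Quotient.mk d (Sum.inr z) then
      κ ⟨Quotient.mk d (Sum.inr z), hz, z, rfl⟩ else c
  have hβ : ∀ z z', d (Sum.inr z) (Sum.inr z') → β z = β z' := fun z z' h => by
    have : Quotient.mk d (Sum.inr z) = Quotient.mk d (Sum.inr z') := Quotient.sound h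
    simp only [β, this]
  have hβ' : ∀ x z x' z', d (Sum.inl x) (Sum.inr z) → d (Sum.inl x') (Sum.inr z') →
      β z = β z' → d (Sum.inr z) (Sum.inr z') := fun x z x' z' h h' e => by
    have hz : ∃ i, Quotient.mk d (Sum.inl i) = Quotient.mk d (Sum.inr z) := ⟨x, Quotient.sound h⟩
    have hz' : ∃ i, Quotient.mk d (Sum.inl i) = Quotient.mk d (Sum.inr z') :=
      ⟨x', Quotient.sound h'⟩
    simp only [β, dif_pos hz, dif_pos hz'] at e
    exact Quotient.exact (congrArg Subtype.val (κ.injective (Subtype.ext e)))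
  have hβc : ∀ x, d (Sum.inl x) (Sum.inr c) → β c = c := fun x hx => by
    have hz : ∃ i, Quotient.mk d (Sum.inl i) = Quotient.mk d (Sum.inr c) := ⟨x, Quotient.sound hx⟩
    simp only [β, dif_pos hz]
    exact congrArg Subtype.val (hκ ⟨x, hx⟩)
  let α : Fin (m + 1) → Fin (m + 1) := fun y =>
    if y = c ∧ ∃ x, d (Sum.inl x) (Sum.inr c) then c else
      if hy : ∃ z, (∃ x, d (Sum.inl x) (Sum.inr z)) ∧ β z = y then hy.choose else c
  refine ⟨α, β, hβ, fun x z hxz => ?_, fun z => ?_, fun x hx => ⟨hβc x hx, ?_⟩⟩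
  · by_cases hz : β z = c ∧ ∃ x, d (Sum.inl x) (Sum.inr c)
    · simp only [α, if_pos hz]
      obtain ⟨hz, x', hx'⟩ := hz
      exact hβ' x' c x z hx' hxz ((hβc x' hx').trans hz.symm)
    · have hy : ∃ z', (∃ x, d (Sum.inl x) (Sum.inr z')) ∧ β z' = β z := ⟨z, ⟨x, hxz⟩, rfl⟩
      simp only [α, if_neg hz, dif_pos hy]
      obtain ⟨⟨x', hx'⟩, e⟩ := hy.choose_spec
      exact hβ' x' _ x z hx' hxz e
  · by_cases hz : ∃ i, Quotient.mk d (Sum.inl i) = Quotient.mk d (Sum.inr z)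
    · simp only [β, dif_pos hz]
      exact (κ _).2
    · simp only [β, dif_neg hz]
      exact hc
  · exact if_pos ⟨rfl, x, hx⟩

end Diagram

namespace PartitionAlgebra

open SetPartition Diagram

variable {m : ℕ} {n : ℂ}

/-! ### Factoring diagrams through `p_k` -/

theorem graph_comp_aux (θ θ' : Fin m → Fin m) :
    loops (graph θ) (graph θ') = 0 ∧ comp (graph θ) (graph θ') = graph (θ' ∘ θ) := by
  refine scaled_ext fun c => ?_
  obtain ⟨X, Y, rfl⟩ := elim_surj c
  refine (congrFun (congrFun (mat_mul_mat (graph θ) (graph θ')) X) Y).symm.trans ?_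
  rw [pow_zero, one_mul]
  change _ = mat (graph (θ' ∘ θ)) X Y
  simp [Matrix.mul_apply, mat_graph, ← Function.comp_assoc]

theorem diag_graph_mul (θ θ' : Fin m → Fin m) :
    diag n (graph θ) * diag n (graph θ') = diag n (graph (θ' ∘ θ)) := by
  rw [diag_mul_diag, (graph_comp_aux θ θ').1, (graph_comp_aux θ θ').2, pow_zero, one_smul]

theorem diag_tie_mul_p {h c : Fin m} (hc : c ≠ h) :
    diag n (tie c h) * diag n (Diagram.p h) = diag n (graph (Function.update id h c)) := by
  classical
  refine ((hasMatrix_diag _).mul (hasMatrix_diag _)).unique ((hasMatrix_diag _).congr ?_)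
  ext X Y
  simp only [Matrix.mul_apply, mat_graph, mat_tie, mat_p]
  have hY : X = Y ∘ Function.update id h c ↔ X c = X h ∧ ∀ i, i ≠ h → X i = Y i := by
    rw [funext_iff]
    constructor
    · intro hX
      have := hX h
      have hXc := hX c
      simp only [Function.comp, Function.update_self, Function.update_of_ne hc, id] at this hXc
      refine ⟨hXc.trans this.symm, fun i hi => ?_⟩
      simpa [Function.update_of_ne hi] using hX i
    · rintro ⟨h₁, h₂⟩ i
      by_cases hi : i = h
      · subst hi
        simpa [← h₁] using h₂ c hc
      · simpa [Function.update_of_ne hi] using h₂ i hi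
  rw [Finset.sum_eq_single X]
  · simp only [hY, true_and, ← ite_and, ite_mul, one_mul, zero_mul]
  · intro Z _ hZ
    simp [hZ.symm]
  · simp

/-- A diagram absorbs the relabelling of its bottom row by a map `θ` that preserves the propagating
blocks and collapses every other block, once the blocks of the bottom row are restored. -/
theorem diag_mul_graph_mul_bottomMerge (d : Diagram m) {θ : Fin m → Fin m}
    (h₁ : ∀ z z', d (Sum.inr z) (Sum.inr z') → θ z = θ z')
    (h₂ : ∀ x z, d (Sum.inl x) (Sum.inr z) → d (Sum.inr (θ z)) (Sum.inr z)) :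
    diag n d * diag n (graph θ) * diag n (bottomMerge d) = diag n d := by
  refine (((hasMatrix_diag _).mul (hasMatrix_diag _)).mul (hasMatrix_diag _)).unique
    ((hasMatrix_diag _).congr ?_)
  ext X Y
  simp only [Matrix.mul_apply, mat_graph, mat_bottomMerge]
  simp only [mul_ite, mul_one, mul_zero, Finset.sum_ite_eq', Finset.mem_univ, if_true]
  have key : d ≤ Setoid.ker (Sum.elim X (Y ∘ θ)) ∧ d.comap Sum.inr ≤ Setoid.ker Y ↔
      d ≤ Setoid.ker (Sum.elim X Y) := by
    constructor
    · rintro ⟨ha, hb⟩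
      have hθ : ∀ x z, d (Sum.inl x) (Sum.inr z) → Y (θ z) = Y z := fun x z hxz =>
        hb (h₂ x z hxz)
      rintro (u | u) (v | v) huv
      · exact ha huv
      · have : X u = Y (θ v) := ha huv
        exact this.trans (hθ u v huv)
      · have : Y (θ u) = X v := ha huv
        exact (hθ v u (d.symm huv)).symm.trans this
      · exact hb huv
    · intro h
      refine ⟨?_, fun u v huv => h huv⟩
      have hθ : ∀ x z, d (Sum.inl x) (Sum.inr z) → Y (θ z) = Y z := fun x z hxz =>
        h (h₂ x z hxz)
      rintro (u | u) (v | v) huv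
      · exact h huv
      · have : X u = Y v := h huv
        exact this.trans (hθ u v huv).symm
      · have : Y u = X v := h huv
        exact (hθ v u (d.symm huv)).trans this
      · exact congrArg Y (h₁ u v huv)
  by_cases hA : d ≤ Setoid.ker (Sum.elim X (Y ∘ θ)) <;>
    by_cases hB : d.comap Sum.inr ≤ Setoid.ker Y <;> simp [mat, wt, ← key, hA, hB]

/-- A diagram that is not a permutation factors through `tie c h * p h`. -/
theorem exists_diag_mul_graph (d : Diagram (m + 1)) (hd : d.pn < m + 1) {h c : Fin (m + 1)}
    (hc : c ≠ h) : ∃ α β : Fin (m + 1) → Fin (m + 1),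
      diag n d * diag n (graph β) * (diag n (tie c h) * diag n (Diagram.p h)) *
        (diag n (graph α) * diag n (bottomMerge d)) = diag n d ∧
      ∀ x, d (Sum.inl x) (Sum.inr c) → β c = c ∧ α c = c := by
  obtain ⟨α, β, h₁, h₂, h₃, h₄⟩ := exists_labels d hd hc
  refine ⟨α, β, ?_, h₄⟩
  have e : α ∘ Function.update id h c ∘ β = α ∘ β := by
    funext z
    simp [Function.update_of_ne (h₃ z)]
  rw [diag_tie_mul_p hc, mul_assoc (diag n d), diag_graph_mul, ← mul_assoc, mul_assoc (diag n d),
    diag_graph_mul, e]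
  exact diag_mul_graph_mul_bottomMerge d (fun z z' h => congrArg α (h₁ z z' h)) h₂

/-- Right regularity in `ℂA_k(n)` for integers `k ≥ 2`: `d` lies in `d P p P`. The strand tied to the
last one keeps the last vertex from forming a loop, so that no factor `n` occurs. -/
theorem exists_mul_pInt_mul {d : Diagram (m + 2)} (hd : d.pn < m + 2) :
    ∃ w v, diag n d * w * pInt (m + 1) n * v = diag n d := by
  obtain ⟨α, β, h, -⟩ := exists_diag_mul_graph (n := n) d hd (h := Fin.last (m + 1)) (c := 0)
    (Fin.last_pos).ne
  refine ⟨diag n (graph β) * diag n (tie 0 (Fin.last (m + 1))),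
    diag n (graph α) * diag n (bottomMerge d), ?_⟩
  simpa only [mul_assoc, pInt] using h

theorem exists_pInt_mul_mul {d : Diagram (m + 2)} (hd : d.pn < m + 2) :
    ∃ w v, w * pInt (m + 1) n * v * diag n d = diag n d := by
  obtain ⟨w, v, h⟩ := exists_mul_pInt_mul (n := n) (pn_mirror_lt hd)
  refine ⟨mirrorMap _ n v, mirrorMap _ n w, ?_⟩
  have h' := congrArg (mirrorMap _ n) h
  simpa only [mirrorMap_mul, mirrorMap_diag, mirror_mirror, pInt, mirror_p, mul_assoc] using h'

theorem isHalf_graph {θ : Fin (m + 1) → Fin (m + 1)} (h : θ (Fin.last m) = Fin.last m) :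
    (graph θ).IsHalf := h

theorem isHalf_bottomMerge (d : Diagram (m + 1)) : d.bottomMerge.IsHalf :=
  (le_sup_left : _ ≤ d.bottomMerge) (isHalf_one : (one (m + 1)).IsHalf)

theorem isHalf_p_castSucc (i : Fin m) : (Diagram.p i.castSucc).IsHalf := by
  refine Prod.ext rfl ?_
  exact decide_eq_false (Fin.castSucc_lt_last i).ne'

/-- Right regularity in `ℂA_{k+1/2}(n)`. Since the last strand of `d` propagates, it can be given its
own label, which keeps the factors in `ℂA_{k+1/2}(n)`. -/
theorem exists_mul_pHalf_mul {d : Diagram (m + 2)} (hd : d.IsHalf) (hpn : d.pn < m + 2) :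
    ∃ w v, diagHalf n d hd * w * pHalf m n * v = diagHalf n d hd := by
  obtain ⟨α, β, h, h'⟩ := exists_diag_mul_graph (n := n) d hpn
    (h := (Fin.last m).castSucc) (c := Fin.last (m + 1)) (Fin.castSucc_lt_last _).ne'
  obtain ⟨hβ, hα⟩ := h' _ hd
  refine ⟨diagHalf n (graph β) (isHalf_graph hβ), diagHalf n _ (isHalf_p_castSucc (Fin.last m)) *
    (diagHalf n (graph α) (isHalf_graph hα) * diagHalf n _ (isHalf_bottomMerge d)),
    Subtype.ext ?_⟩
  rw [← Fin.succ_last, ← pHalf_eq_tie] at h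
  simp only [mul_assoc] at h ⊢
  exact h

theorem mirrorMap_mem_half (x : half m n) : mirrorMap (m + 1) n x ∈ half m n := by
  induction x using half_induction_on with
  | diag d hd =>
    change mirrorMap (m + 1) n (diag n d) ∈ half m n
    rw [mirrorMap_diag]
    exact diag_mem_half hd.mirror
  | add x y hx hy =>
    rw [Subalgebra.coe_add, map_add]
    exact add_mem hx hy
  | smul c x hx =>
    rw [Subalgebra.coe_smul, map_smul]
    exact Subalgebra.smul_mem _ hx c

theorem mirror_tie (u v : Fin m) : (tie u v).mirror = tie u v := by
  apply mat_injective
  rw [mat_mirror]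
  ext X Y
  rw [Matrix.transpose_apply, mat_tie, mat_tie]
  congr 1
  apply propext
  constructor <;> rintro ⟨rfl, h⟩ <;> exact ⟨rfl, h⟩

theorem exists_pHalf_mul_mul {d : Diagram (m + 2)} (hd : d.IsHalf) (hpn : d.pn < m + 2) :
    ∃ w v, w * pHalf m n * v * diagHalf n d hd = diagHalf n d hd := by
  obtain ⟨w, v, h⟩ := exists_mul_pHalf_mul (n := n) hd.mirror (pn_mirror_lt hpn)
  refine ⟨⟨_, mirrorMap_mem_half v⟩, ⟨_, mirrorMap_mem_half w⟩, Subtype.ext ?_⟩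
  have h' := congrArg (fun x : half (m + 1) n => mirrorMap _ n (x : PartitionAlgebra (m + 2) n)) h
  have hp : mirrorMap _ n (pHalf m n : PartitionAlgebra (m + 2) n) = pHalf m n := by
    change mirrorMap _ n (diag n _) = diag n _
    rw [mirrorMap_diag, pHalf_eq_tie, mirror_tie]
  have hd' : mirrorMap _ n (diagHalf n d.mirror hd.mirror : PartitionAlgebra (m + 2) n) =
      diagHalf n d hd := by
    change mirrorMap _ n (diag n _) = diag n _
    rw [mirrorMap_diag, mirror_mirror]
  simpa only [Subalgebra.coe_mul, mirrorMap_mul, hp, hd', mul_assoc] using h'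

end PartitionAlgebra

/-! ### The basic construction implemented by an element -/

namespace BasicConstruction

variable {A B P : Type} [Ring A] [Ring B] [Ring P] [Algebra ℂ A] [Algebra ℂ B] [Algebra ℂ P]
variable {ι : A →ₐ[ℂ] B} {j : B →ₐ[ℂ] P}

theorem smul_tmul (ε : BimoduleMap ι) (c : ℂ) (b₁ b₂ : B) :
    tmul ε (c • b₁) b₂ = c • tmul ε b₁ b₂ := rfl

theorem tmul_smul (ε : BimoduleMap ι) (c : ℂ) (b₁ b₂ : B) :
    tmul ε b₁ (c • b₂) = c • tmul ε b₁ b₂ := by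
  rw [tmul, TensorProduct.tmul_smul]
  rfl

theorem span_tmul {ε : BimoduleMap ι} {S : Set B} (hS : Submodule.span ℂ S = ⊤) :
    Submodule.span ℂ {t : BasicConstruction ε | ∃ b₁ ∈ S, ∃ b₂ ∈ S, t = tmul ε b₁ b₂} = ⊤ := by
  rw [← Submodule.ker_mkQ (Submodule.span ℂ _), LinearMap.ker_eq_top]
  refine hom_ext ε fun b₁ b₂ => ?_
  set Q := (Submodule.span ℂ {t : BasicConstruction ε | ∃ b₁ ∈ S, ∃ b₂ ∈ S,
    t = tmul ε b₁ b₂}).mkQ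
  let T : B →ₗ[ℂ] B →ₗ[ℂ] _ :=
    (TensorProduct.mk ℂ B B).compr₂ (Q ∘ₗ (balancedRelations ι).mkQ)
  have hT : T = 0 := by
    refine LinearMap.ext_on hS fun b₁ h₁ => LinearMap.ext_on hS fun b₂ h₂ => ?_
    change Q (tmul ε b₁ b₂) = 0
    rw [← LinearMap.mem_ker, Submodule.ker_mkQ]
    exact Submodule.subset_span ⟨b₁, h₁, b₂, h₂, rfl⟩
  exact LinearMap.congr_fun (LinearMap.congr_fun hT b₁) b₂

/-- An element `p` that commutes with `A` and satisfies `p b p = ε(b) p` for `b ∈ B` implements the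
basic construction: `b₁ ⊗ b₂ ↦ b₁ p b₂` is a homomorphism of algebras. -/
theorem exists_hom (ε : BimoduleMap ι) {p : P} (hcomm : ∀ a, p * j (ι a) = j (ι a) * p)
    (hp : ∀ b, p * j b * p = j (ι (ε.map b)) * p) :
    ∃ f : BasicConstruction ε →ₙₐ[ℂ] P, ∀ b₁ b₂, f (tmul ε b₁ b₂) = j b₁ * p * j b₂ := by
  let F : BasicConstruction ε →ₗ[ℂ] P := lift ε
    ((LinearMap.mul ℂ P).compl₁₂ (LinearMap.mulRight ℂ p ∘ₗ j.toLinearMap) j.toLinearMap)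
    (fun b₁ a b₂ => by
      change j (b₁ * ι a) * p * j b₂ = j b₁ * p * j (ι a * b₂)
      rw [map_mul, map_mul, mul_assoc (j b₁) (j (ι a)) p, ← hcomm]
      simp only [mul_assoc])
  have hF : ∀ b₁ b₂, F (tmul ε b₁ b₂) = j b₁ * p * j b₂ := fun _ _ => rfl
  have hmul : ∀ x y, F (x * y) = F x * F y := by
    have : (mulHom ε).compr₂ F = (LinearMap.mul ℂ P).compl₁₂ F F := by
      refine hom_ext ε fun b₁ b₂ => hom_ext ε fun b₃ b₄ => ?_
      change F (tmul ε b₁ b₂ * tmul ε b₃ b₄) = F (tmul ε b₁ b₂) * F (tmul ε b₃ b₄)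
      rw [tmul_mul_tmul, hF, hF, hF, map_mul, mul_assoc (j b₁), ← mul_assoc p, hcomm, ← hp,
        map_mul]
      simp only [mul_assoc]
    exact fun x y => LinearMap.congr_fun (LinearMap.congr_fun this x) y
  exact ⟨{ F with
      map_mul' := hmul
      map_zero' := map_zero F }, hF⟩

/-- If the products `b₁ p b₂` of basis elements are multiples of members of a family `I` whose
canonical preimages `G d` control the tensors `b₁ ⊗ b₂`, then `b₁ ⊗ b₂ ↦ b₁ p b₂` is injective with
image the span of `I`. -/
theorem injective_and_range {ε : BimoduleMap ι} {p : P} (f : BasicConstruction ε →ₙₐ[ℂ] P)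
    (hf : ∀ b₁ b₂, f (tmul ε b₁ b₂) = j b₁ * p * j b₂) {S : Set B}
    (hS : Submodule.span ℂ S = ⊤) {I : Set P}
    (hI : ∀ G : P → BasicConstruction ε, ∃ g : P →ₗ[ℂ] BasicConstruction ε, ∀ d ∈ I, g d = G d)
    (hmul : ∀ b₁ ∈ S, ∀ b₂ ∈ S, ∃ c : ℂ, ∃ d ∈ I, j b₁ * p * j b₂ = c • d)
    (G : P → BasicConstruction ε) (hG : ∀ d ∈ I, f (G d) = d)
    (hGt : ∀ b₁ ∈ S, ∀ b₂ ∈ S, ∀ c : ℂ, ∀ d ∈ I, j b₁ * p * j b₂ = c • d →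
      tmul ε b₁ b₂ = c • G d) :
    Function.Injective f ∧ Set.range f = Submodule.span ℂ I := by
  obtain ⟨g, hg⟩ := hI G
  let F : BasicConstruction ε →ₗ[ℂ] P := (f : BasicConstruction ε →ₗ[ℂ] P)
  have hF : ∀ x, F x = f x := fun _ => rfl
  have hgf : g ∘ₗ F = LinearMap.id := by
    refine LinearMap.ext_on (span_tmul hS) ?_
    rintro _ ⟨b₁, h₁, b₂, h₂, rfl⟩
    obtain ⟨c, d, hd, h⟩ := hmul b₁ h₁ b₂ h₂
    change g (f (tmul ε b₁ b₂)) = tmul ε b₁ b₂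
    rw [hf, h, map_smul, hg d hd, ← hGt b₁ h₁ b₂ h₂ c d hd h]
  refine ⟨fun x y hxy => ?_, ?_⟩
  · have := congrArg g hxy
    exact (LinearMap.congr_fun hgf x).symm.trans (this.trans (LinearMap.congr_fun hgf y))
  · have : LinearMap.range F = Submodule.span ℂ I := by
      apply le_antisymm
      · rw [LinearMap.range_eq_map, ← span_tmul hS, Submodule.map_span, Submodule.span_le]
        rintro _ ⟨_, ⟨b₁, h₁, b₂, h₂, rfl⟩, rfl⟩
        obtain ⟨c, d, hd, h⟩ := hmul b₁ h₁ b₂ h₂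
        rw [hF, hf, h]
        exact Submodule.smul_mem _ _ (Submodule.subset_span hd)
      · rw [Submodule.span_le]
        exact fun d hd => ⟨G d, hG d hd⟩
    rw [← this]
    rfl

/-- If `P p = B p`, `p P = p B` and every `d ∈ I` lies in `d P p P` and in `P p P d`, then
`b₁ ⊗ b₂ ↦ b₁ p b₂` is an isomorphism onto the span of `I`. The bimodule map `E : P → B` with
`E p = 1` serves to cancel `p` in `b p = b' p` and in `p b = p b'`. -/
theorem injective_and_range_of_regular {ε : BimoduleMap ι} (E : BimoduleMap j) {p : P}
    (hcomm : ∀ a, p * j (ι a) = j (ι a) * p)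
    (hp : ∀ b, p * j b * p = j (ι (ε.map b)) * p) (hE : E.map p = 1)
    (hr : ∀ a, a * p = j (E.map (a * p)) * p) (hl : ∀ a, p * a = p * j (E.map (p * a)))
    (f : BasicConstruction ε →ₙₐ[ℂ] P)
    (hf : ∀ b₁ b₂, f (tmul ε b₁ b₂) = j b₁ * p * j b₂) {S : Set B}
    (hS : Submodule.span ℂ S = ⊤) (hone : 1 ∈ S) {I : Set P}
    (hI : ∀ G : P → BasicConstruction ε, ∃ g : P →ₗ[ℂ] BasicConstruction ε, ∀ d ∈ I, g d = G d)
    (hmul : ∀ b₁ ∈ S, ∀ b₂ ∈ S, ∃ c : ℂ, ∃ d ∈ I, j b₁ * p * j b₂ = c • d)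
    (hR : ∀ d ∈ I, ∃ w v, d * w * p * v = d) (hL : ∀ d ∈ I, ∃ w v, w * p * v * d = d) :
    Function.Injective f ∧ Set.range f = Submodule.span ℂ I := by
  have cancel_right : ∀ b b', j b * p = j b' * p → b = b' := fun b b' h => by
    have := congrArg E.map h
    simpa only [E.map_left, hE, mul_one] using this
  have cancel_left : ∀ b b', p * j b = p * j b' → b = b' := fun b b' h => by
    have := congrArg E.map h
    simpa only [E.map_right, hE, one_mul] using this
  choose! w v hwv using hR
  have hd : ∀ d ∈ I, j (E.map (d * w d * p)) * p * j (E.map (p * v d)) = d := fun d hd => by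
    rw [← hr (d * w d), mul_assoc (d * w d), ← hl, ← mul_assoc, hwv d hd]
  refine injective_and_range f hf hS hI hmul
    (fun d => tmul ε (E.map (d * w d * p)) (E.map (p * v d)))
    (fun d hdI => by rw [hf]; exact hd d hdI) ?_
  intro b₁ h₁ b₂ h₂ c d hdI hbd
  obtain ⟨V, W, hVW⟩ : ∃ V W, j V * p * j W * (j b₁ * p) = j b₁ * p := by
    obtain ⟨c', d', hd', h'⟩ := hmul b₁ h₁ 1 hone
    rw [map_one, mul_one] at h'
    obtain ⟨w', v', h⟩ := hL d' hd'
    refine ⟨E.map (w' * p), E.map (p * v'), ?_⟩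
    rw [← hr w', mul_assoc w', ← hl, h', mul_smul_comm, ← mul_assoc, h]
  set x := E.map (d * w d * p)
  set y := E.map (p * v d)
  have hxp : j x * p = d * w d * p := (hr _).symm
  have hxy : j x * p * j y = d := hd d hdI
  have e₁ : b₁ = V * ι (ε.map (W * b₁)) := cancel_right _ _ <| by
    rw [map_mul j, mul_assoc (j V), ← hp, map_mul j W, ← hVW]
    simp only [mul_assoc]
  have e₂ : ι (ε.map (W * b₁)) * b₂ = c • (ι (ε.map (W * x)) * y) := cancel_left _ _ <| by
    rw [map_smul, mul_smul_comm, map_mul j, map_mul j, ← mul_assoc, ← mul_assoc, hcomm, hcomm,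
      ← hp, ← hp, map_mul j, map_mul j]
    have h := congrArg (fun z => p * j W * z) (hbd.trans (congrArg (c • ·) hxy.symm))
    simp only [mul_smul_comm] at h
    simpa only [mul_assoc] using h
  have e₃ : c • (V * ι (ε.map (W * x))) = c • x := cancel_right _ _ <| by
    rw [map_smul, map_smul, smul_mul_assoc, smul_mul_assoc, map_mul j, mul_assoc (j V), ← hp,
      map_mul j, hxp]
    calc c • (j V * (p * (j W * j x) * p)) = j V * p * j W * (c • d) * w d * p := by
          rw [mul_smul_comm, smul_mul_assoc, smul_mul_assoc, mul_assoc _ d, mul_assoc _ (d * w d),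
            ← hxp]
          simp only [mul_assoc]
      _ = j V * p * j W * (j b₁ * p) * j b₂ * w d * p := by
          rw [← hbd]
          simp only [mul_assoc]
      _ = c • (d * w d * p) := by
          rw [hVW, hbd, smul_mul_assoc, smul_mul_assoc]
  calc tmul ε b₁ b₂ = tmul ε V (ι (ε.map (W * b₁)) * b₂) := by
        rw [← tmul_balanced, ← e₁]
    _ = c • tmul ε (V * ι (ε.map (W * x))) y := by
        rw [e₂, tmul_balanced]
        exact tmul_smul _ _ _ _
    _ = tmul ε (c • (V * ι (ε.map (W * x)))) y := (smul_tmul _ _ _ _).symm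
    _ = c • tmul ε x y := by
        rw [e₃, smul_tmul]

end BasicConstruction

/-! ### The quotient by the span of the diagrams that are not permutations -/

/-- Let `b` be a spanning family of an algebra `R` in which a group `G` is represented by the members
`b (r g)`. If the linear map `π` that sends `b (r g)` to `g` and kills the other members also kills
the products with these, then their span is a two-sided ideal with quotient `ℂG`. -/
theorem exists_quotient_algEquiv {R G S : Type} [Ring R] [Algebra ℂ R] [Group G] (b : S → R)
    (r : G → S) (hspan : Submodule.span ℂ (Set.range b) = ⊤) (hone : b (r 1) = 1)
    (hr : ∀ g h, b (r g) * b (r h) = b (r (g * h))) (π : R →ₗ[ℂ] MonoidAlgebra ℂ G)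
    (hπr : ∀ g, π (b (r g)) = MonoidAlgebra.of ℂ G g)
    (hπ : ∀ s, s ∉ Set.range r → π (b s) = 0)
    (hmul : ∀ s t, (s ∉ Set.range r ∨ t ∉ Set.range r) → π (b s * b t) = 0) :
    ∃ (J : Ideal R) (_ : J.IsTwoSided),
      (J : Set R) = Submodule.span ℂ {x | ∃ s, s ∉ Set.range r ∧ x = b s} ∧
      ∃ e : (R ⧸ J) ≃ₐ[ℂ] MonoidAlgebra ℂ G,
        ∀ g, e (Ideal.Quotient.mk J (b (r g))) = MonoidAlgebra.of ℂ G g := by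
  have hπmul : ∀ x y, π (x * y) = π x * π y := by
    have : (LinearMap.mul ℂ R).compr₂ π = (LinearMap.mul ℂ _).compl₁₂ π π := by
      refine LinearMap.ext_on hspan ?_
      rintro _ ⟨s, rfl⟩
      refine LinearMap.ext_on hspan ?_
      rintro _ ⟨t, rfl⟩
      change π (b s * b t) = π (b s) * π (b t)
      by_cases hs : s ∈ Set.range r
      · by_cases ht : t ∈ Set.range r
        · obtain ⟨g, rfl⟩ := hs
          obtain ⟨h, rfl⟩ := ht
          rw [hr, hπr, hπr, hπr, map_mul]
        · rw [hmul s t (Or.inr ht), hπ t ht, mul_zero]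
      · rw [hmul s t (Or.inl hs), hπ s hs, zero_mul]
    exact fun x y => LinearMap.congr_fun (LinearMap.congr_fun this x) y
  let f : R →ₐ[ℂ] MonoidAlgebra ℂ G :=
    AlgHom.ofLinearMap π (by rw [← hone, hπr, map_one]) hπmul
  let σ : MonoidAlgebra ℂ G →ₐ[ℂ] R := MonoidAlgebra.lift ℂ R G
    { toFun := fun g => b (r g)
      map_one' := hone
      map_mul' := fun g h => (hr g h).symm }
  have hσ : ∀ g, σ (MonoidAlgebra.of ℂ G g) = b (r g) := fun g =>
    MonoidAlgebra.lift_of (R := ℂ) (A := R) _ g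
  have hfσ : f.comp σ = AlgHom.id ℂ _ := by
    refine MonoidAlgebra.algHom_ext (fun g => ?_) (Subsingleton.elim _ _)
    change π (σ (MonoidAlgebra.of ℂ G g)) = MonoidAlgebra.of ℂ G g
    rw [hσ, hπr]
  have hsurj : Function.Surjective f := fun x => ⟨σ x, AlgHom.congr_fun hfσ x⟩
  set N := Submodule.span ℂ {x | ∃ s, s ∉ Set.range r ∧ x = b s} with hN
  have hker : ∀ x, x - σ (π x) ∈ N := by
    have : N.mkQ ∘ₗ (LinearMap.id - σ.toLinearMap ∘ₗ π) = 0 := by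
      refine LinearMap.ext_on hspan ?_
      rintro _ ⟨s, rfl⟩
      change N.mkQ (b s - σ (π (b s))) = 0
      rw [← LinearMap.mem_ker, Submodule.ker_mkQ]
      by_cases hs : s ∈ Set.range r
      · obtain ⟨g, rfl⟩ := hs
        rw [hπr, hσ, sub_self]
        exact N.zero_mem
      · rw [hπ s hs, map_zero, sub_zero]
        exact Submodule.subset_span ⟨s, hs, rfl⟩
    intro x
    rw [← Submodule.ker_mkQ N]
    exact LinearMap.congr_fun this x
  have hle : N ≤ LinearMap.ker π := by
    rw [hN, Submodule.span_le]
    rintro _ ⟨s, hs, rfl⟩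
    exact hπ s hs
  refine ⟨RingHom.ker f, inferInstance, ?_, Ideal.quotientKerAlgEquivOfSurjective hsurj,
    fun g => hπr g⟩
  ext x
  constructor
  · intro hx
    have hx' : π x = 0 := hx
    have := hker x
    rwa [hx', map_zero, sub_zero] at this
  · exact fun hx => hle hx

namespace Diagram

open SetPartition PartitionAlgebra

variable {m : ℕ}

theorem ofPerm_eq_graph (σ : Equiv.Perm (Fin m)) : ofPerm σ = graph σ.symm := by
  ext u v
  change Sum.elim (fun i => i) (fun j => σ j) u = Sum.elim (fun i => i) (fun j => σ j) v ↔
    Sum.elim σ.symm id u = Sum.elim σ.symm id v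
  cases u <;> cases v <;> simp [Equiv.eq_symm_apply, Equiv.symm_apply_eq]

theorem ofPerm_one : ofPerm (1 : Equiv.Perm (Fin m)) = one m := rfl

theorem eq_of_ofPerm_le {σ τ : Equiv.Perm (Fin m)} (h : ofPerm σ ≤ ofPerm τ) : σ = τ := by
  ext j
  have h' : ofPerm σ (Sum.inl (σ j)) (Sum.inr j) := rfl
  have : σ j = τ j := h h'
  rw [this]

theorem ofPerm_injective : Function.Injective (ofPerm : Equiv.Perm (Fin m) → Diagram m) :=
  fun _ _ h => eq_of_ofPerm_le h.le

theorem addStrand_injective : Function.Injective (addStrand : Diagram m → Diagram (m + 1)) := by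
  intro d e h
  refine (scaled_ext (a := 0) (b := 0) fun c => ?_).2
  obtain ⟨x, y, rfl⟩ := elim_surj c
  have := wt_addStrand d x y true true
  rw [h, wt_addStrand] at this
  simpa using this.symm

theorem addStrand_removeLast_le {d : Diagram (m + 1)} (hd : d.IsHalf) :
    d.removeLast.addStrand ≤ d := by
  refine sup_le (Setoid.eqvGen_le ?_) (Setoid.eqvGen_le ?_)
  · rintro _ _ ⟨u, v, huv, rfl, rfl⟩
    exact huv
  · rintro _ _ ⟨rfl, rfl⟩
    exact hd

theorem exists_addStrand_ofPerm_eq (σ : Equiv.Perm (Fin m)) :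
    ∃ τ, (ofPerm σ).addStrand = ofPerm τ := by
  have h : comp (ofPerm σ) (ofPerm σ⁻¹) = one m := by
    rw [ofPerm_eq_graph, ofPerm_eq_graph, (graph_comp_aux _ _).2, ← ofPerm_one, ofPerm_eq_graph]
    exact congrArg graph (funext σ.apply_symm_apply)
  refine left_of_comp_eq_ofPerm (e := (ofPerm σ⁻¹).addStrand) (σ := 1) ?_
  rw [(addStrand_comp_aux _ _).2, h, addStrand_one, ofPerm_one]

/-- A permutation diagram that fixes the last strand arises by adding that strand. -/
theorem IsHalf.exists_eq_addStrand {τ : Equiv.Perm (Fin (m + 1))} (h : (ofPerm τ).IsHalf) :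
    ∃ σ, ofPerm τ = (ofPerm σ).addStrand := by
  have hτ : Fin.last m = τ (Fin.last m) := h
  obtain ⟨σ, hσ⟩ : ∃ σ, (ofPerm τ).removeLast = ofPerm σ := by
    refine exists_eq_ofPerm (fun i i' hi => Fin.castSucc_injective m hi) fun i => ?_
    obtain ⟨j, hj⟩ := τ.surjective i.castSucc
    obtain ⟨j, rfl⟩ : ∃ j', Fin.castSucc j' = j := Fin.exists_castSucc_eq.2 fun hj' => by
      rw [hj', ← hτ] at hj
      exact (Fin.castSucc_lt_last i).ne hj.symm
    exact ⟨j, hj.symm⟩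
  obtain ⟨τ', hτ'⟩ := exists_addStrand_ofPerm_eq σ
  refine ⟨σ, ?_⟩
  have hle := addStrand_removeLast_le h
  rw [hσ, hτ'] at hle
  rw [hτ', eq_of_ofPerm_le hle]

theorem IsHalf.mem_range_iff {d : Diagram (m + 1)} (hd : d.IsHalf) :
    d ∈ Set.range (fun σ : Equiv.Perm (Fin m) => (ofPerm σ).addStrand) ↔ ∃ τ, d = ofPerm τ := by
  constructor
  · rintro ⟨σ, rfl⟩
    exact exists_addStrand_ofPerm_eq σ
  · rintro ⟨τ, rfl⟩
    obtain ⟨σ, h⟩ := hd.exists_eq_addStrand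
    exact ⟨σ, h.symm⟩

end Diagram

namespace PartitionAlgebra

open SetPartition Diagram

variable {m : ℕ} {n : ℂ}

theorem diag_ofPerm_mul (σ τ : Equiv.Perm (Fin m)) :
    diag n (ofPerm σ) * diag n (ofPerm τ) = diag n (ofPerm (σ * τ)) := by
  rw [ofPerm_eq_graph, ofPerm_eq_graph, ofPerm_eq_graph, diag_graph_mul]
  rfl

open Classical in
/-- The linear map that sends the diagrams in the image of `r` to the elements of `G` they come from
and the other diagrams to zero. -/
noncomputable def toMonoidAlgebra {G : Type} (n : ℂ) (r : G → Diagram m) :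
    PartitionAlgebra m n →ₗ[ℂ] MonoidAlgebra ℂ G :=
  lift n fun d => if h : ∃ g, r g = d then MonoidAlgebra.single h.choose 1 else 0

theorem toMonoidAlgebra_diag {G : Type} {r : G → Diagram m} (hr : Function.Injective r) (g : G) :
    toMonoidAlgebra n r (diag n (r g)) = MonoidAlgebra.single g 1 := by
  have h : ∃ g', r g' = r g := ⟨g, rfl⟩
  rw [toMonoidAlgebra, lift_diag, dif_pos h, hr h.choose_spec]

theorem toMonoidAlgebra_diag_eq_zero {G : Type} {r : G → Diagram m} {d : Diagram m}
    (hd : d ∉ Set.range r) : toMonoidAlgebra n r (diag n d) = 0 := by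
  rw [toMonoidAlgebra, lift_diag]
  exact dif_neg hd

theorem exists_quotient_idealInt (m : ℕ) (n : ℂ) :
    ∃ (J : Ideal (PartitionAlgebra m n)) (_ : J.IsTwoSided),
      (J : Set (PartitionAlgebra m n)) = idealInt m n ∧
      ∃ e : (PartitionAlgebra m n ⧸ J) ≃ₐ[ℂ] MonoidAlgebra ℂ (Equiv.Perm (Fin m)),
        ∀ σ : Equiv.Perm (Fin m), e (Ideal.Quotient.mk J (diag n (ofPerm σ))) =
          MonoidAlgebra.of ℂ (Equiv.Perm (Fin m)) σ := by
  have h := exists_quotient_algEquiv (diag n : Diagram m → _) ofPerm span_diag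
    (by rw [ofPerm_one]; rfl) diag_ofPerm_mul (toMonoidAlgebra n ofPerm)
    (toMonoidAlgebra_diag ofPerm_injective) (fun _ => toMonoidAlgebra_diag_eq_zero)
    (fun s t hst => by
      rw [diag_mul_diag, map_smul, toMonoidAlgebra_diag_eq_zero, smul_zero]
      rintro ⟨σ, hσ⟩
      rcases hst with hs | ht
      · exact hs (let ⟨τ, hτ⟩ := left_of_comp_eq_ofPerm hσ.symm; ⟨τ, hτ.symm⟩)
      · exact ht (let ⟨τ, hτ⟩ := right_of_comp_eq_ofPerm hσ.symm; ⟨τ, hτ.symm⟩))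
  have hI : idealInt m n = Submodule.span ℂ {x | ∃ s : Diagram m,
      s ∉ Set.range ofPerm ∧ x = diag n s} := by
    simp only [idealInt, pn_lt_iff, Set.mem_range, eq_comm (b := (_ : Diagram m))]
  rwa [hI]

theorem natCast_lt_add_half {a k : ℕ} : (a : ℚ) < k + 1 / 2 ↔ a < k + 1 := by
  constructor
  · intro h
    have : (a : ℚ) < (k + 1 : ℕ) := by
      push_cast
      linarith
    exact_mod_cast this
  · intro h
    have : (a : ℚ) ≤ k := by exact_mod_cast Nat.lt_succ_iff.1 h
    linarith

theorem exists_quotient_idealHalf (m : ℕ) (n : ℂ) :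
    ∃ (J : Ideal (half m n)) (_ : J.IsTwoSided),
      (J : Set (half m n)) = idealHalf m n ∧
      ∃ e : (half m n ⧸ J) ≃ₐ[ℂ] MonoidAlgebra ℂ (Equiv.Perm (Fin m)),
        ∀ σ : Equiv.Perm (Fin m), e (Ideal.Quotient.mk J (toHalf m n (diag n (ofPerm σ)))) =
          MonoidAlgebra.of ℂ (Equiv.Perm (Fin m)) σ := by
  let S := {d : Diagram (m + 1) // d.IsHalf}
  let b : S → half m n := fun d => diagHalf n d.1 d.2
  let r : Equiv.Perm (Fin m) → S := fun σ => ⟨(ofPerm σ).addStrand, isHalf_addStrand _⟩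
  let r' : Equiv.Perm (Fin m) → Diagram (m + 1) := fun σ => (ofPerm σ).addStrand
  have hb : ∀ σ, b (r σ) = toHalf m n (diag n (ofPerm σ)) := fun σ => (toHalf_diag _).symm
  have hr' : Function.Injective r' := addStrand_injective.comp ofPerm_injective
  have hrr' : ∀ s : S, s ∉ Set.range r ↔ ¬ ∃ τ, s.1 = ofPerm τ := fun s => by
    rw [← IsHalf.mem_range_iff s.2, not_iff_not]
    exact ⟨fun ⟨σ, h⟩ => ⟨σ, congrArg Subtype.val h⟩, fun ⟨σ, h⟩ => ⟨σ, Subtype.ext h⟩⟩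
  have hrange : ∀ s : S, s ∉ Set.range r → s.1 ∉ Set.range r' := fun s hs => by
    rwa [IsHalf.mem_range_iff s.2, ← hrr']
  have h := exists_quotient_algEquiv b r
    (by
      rw [← span_diagHalf]
      congr 1
      ext x
      exact ⟨fun ⟨s, hs⟩ => ⟨s.1, s.2, hs.symm⟩, fun ⟨d, hd, h⟩ => ⟨⟨d, hd⟩, h.symm⟩⟩)
    (by rw [hb, ofPerm_one, ← one_def, map_one])
    (fun σ τ => by rw [hb, hb, hb, ← map_mul, diag_ofPerm_mul])
    (toMonoidAlgebra n r' ∘ₗ (half m n).val.toLinearMap)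
    (fun σ => toMonoidAlgebra_diag (n := n) hr' σ)
    (fun s hs => toMonoidAlgebra_diag_eq_zero (n := n) (hrange s hs))
    (fun s t hst => by
      change toMonoidAlgebra n r' (diag n s.1 * diag n t.1) = 0
      rw [diag_mul_diag, map_smul, toMonoidAlgebra_diag_eq_zero, smul_zero]
      rw [IsHalf.mem_range_iff (s.2.comp t.2)]
      rintro ⟨σ, hσ⟩
      rcases hst with hs | ht
      · exact (hrr' s).1 hs (left_of_comp_eq_ofPerm hσ)
      · exact (hrr' t).1 ht (right_of_comp_eq_ofPerm hσ))
  have hI : idealHalf m n = Submodule.span ℂ {x | ∃ s : S, s ∉ Set.range r ∧ x = b s} := by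
    rw [idealHalf]
    congr 1
    ext x
    constructor
    · rintro ⟨d, hd, hpn, rfl⟩
      exact ⟨⟨d, hd⟩, (hrr' _).2 (pn_lt_iff.1 (natCast_lt_add_half.1 hpn)), rfl⟩
    · rintro ⟨s, hs, rfl⟩
      exact ⟨s.1, s.2, natCast_lt_add_half.2 (pn_lt_iff.2 ((hrr' s).1 hs)), rfl⟩
  rw [hI]
  simpa only [hb] using h

/-! ### The basic construction for partition algebras -/

theorem diag_mul_mul (d e g : Diagram m) : diag n d * diag n e * diag n g =
    n ^ (loops d e + loops (comp d e) g) • diag n (comp (comp d e) g) := by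
  rw [diag_mul_diag, smul_mul_assoc, diag_mul_diag, smul_smul, pow_add]

theorem diag_ne_zero (d : Diagram m) : diag n d ≠ 0 := Finsupp.single_ne_zero.2 one_ne_zero

theorem exists_iso_idealInt (m : ℕ) (n : ℂ) :
    ∃ f : BasicConstruction (epsRemove m n) →ₙₐ[ℂ] PartitionAlgebra (m + 1) n,
      (∀ b₁ b₂ : half m n, f (BasicConstruction.tmul _ b₁ b₂) =
        (b₁ : PartitionAlgebra (m + 1) n) * pInt m n * b₂) ∧
      Function.Injective f ∧ Set.range f = idealInt (m + 1) n := by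
  obtain ⟨f, hf⟩ := BasicConstruction.exists_hom (j := ofHalf m n) (p := pInt m n) (epsRemove m n)
    pInt_mul_toHalf pInt_mul_mul_pInt
  refine ⟨f, hf, ?_⟩
  have hI : ∀ G : PartitionAlgebra (m + 1) n → BasicConstruction (epsRemove m n),
      ∃ g : PartitionAlgebra (m + 1) n →ₗ[ℂ] BasicConstruction (epsRemove m n),
        ∀ x ∈ {x | ∃ d : Diagram (m + 1), d.pn < m + 1 ∧ x = diag n d}, g x = G x := fun G => by
    refine ⟨lift n fun d => G (diag n d), ?_⟩
    rintro _ ⟨d, -, rfl⟩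
    exact lift_diag _ d
  have hmul : ∀ b₁ ∈ {x : half m n | ∃ d hd, x = diagHalf n d hd},
      ∀ b₂ ∈ {x : half m n | ∃ d hd, x = diagHalf n d hd}, ∃ c : ℂ,
        ∃ x ∈ {x | ∃ d : Diagram (m + 1), d.pn < m + 1 ∧ x = diag n d},
          ofHalf m n b₁ * pInt m n * ofHalf m n b₂ = c • x := by
    rintro _ ⟨d, hd, rfl⟩ _ ⟨e, he, rfl⟩
    exact ⟨_, _, ⟨_, pn_comp_lt_left (pn_comp_lt_right (pn_p_lt _)), rfl⟩, diag_mul_mul _ _ _⟩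
  cases m with
  | zero =>
    -- Here `B = ℂ`, and `p` need not lie in `p P p P`: this fails when `n = 0`.
    have hrel : ∀ {d : Diagram 1}, d.IsHalf → d = one 1 := fun {d} hd => by
      ext u v
      have hd' : d (Sum.inl 0) (Sum.inr 0) := hd
      have h1 : ∀ u v, d u v := by
        rintro (u | u) (v | v) <;> rw [Subsingleton.elim u 0, Subsingleton.elim v 0]
        · exact hd'
        · exact d.symm hd'
      exact ⟨fun _ => Subsingleton.elim _ _, fun _ => h1 u v⟩
    have hB : ∀ b ∈ {x : half 0 n | ∃ d hd, x = diagHalf n d hd}, b = 1 := by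
      rintro _ ⟨d, hd, rfl⟩
      exact Subtype.ext (congrArg (diag n) (hrel hd))
    have hP : ∀ x ∈ {x | ∃ d : Diagram 1, d.pn < 1 ∧ x = diag n d}, x = pInt 0 n := by
      rintro _ ⟨d, hd, rfl⟩
      refine congrArg (diag n) ?_
      have h1 : ¬ d (Sum.inl 0) (Sum.inr 0) := fun h =>
        pn_lt_iff.1 hd ⟨1, (hrel h).trans ofPerm_one.symm⟩
      have h2 : ¬ Diagram.p (Fin.last 0) (Sum.inl 0) (Sum.inr 0) := fun h => by
        have h3 : ((0, decide ((0 : Fin 1) = Fin.last 0)) : Fin 1 × Bool) = (0, false) := h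
        simp at h3
      have key : ∀ d e : Diagram 1, ¬ d (Sum.inl 0) (Sum.inr 0) → ¬ e (Sum.inl 0) (Sum.inr 0) →
          d ≤ e := by
        rintro d e h h' (u | u) (v | v) huv <;>
          rw [Subsingleton.elim u 0, Subsingleton.elim v 0] at huv ⊢
        · exact absurd huv h
        · exact absurd (d.symm huv) h
      exact le_antisymm (key _ _ h1 h2) (key _ _ h2 h1)
    refine BasicConstruction.injective_and_range f hf span_diagHalf hI hmul
      (fun _ => BasicConstruction.tmul _ 1 1) (fun x hx => ?_) ?_
    · rw [hf, hP x hx, map_one, one_mul, mul_one]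
    · intro b₁ h₁ b₂ h₂ c x hx h
      rw [hB b₁ h₁, hB b₂ h₂, hP x hx, map_one, one_mul, mul_one] at h
      have hc : c = 1 := by
        have : (c - 1) • pInt 0 n = 0 := by rw [sub_smul, one_smul, ← h, sub_self]
        exact sub_eq_zero.1 ((smul_eq_zero.1 this).resolve_right (diag_ne_zero _))
      rw [hB b₁ h₁, hB b₂ h₂, hc, one_smul]
  | succ m =>
    refine BasicConstruction.injective_and_range_of_regular (epsMerge (m + 1) n) pInt_mul_toHalf
      pInt_mul_mul_pInt epsMerge_pInt mul_pInt pInt_mul f hf span_diagHalf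
      ⟨one _, isHalf_one, rfl⟩ hI hmul ?_ ?_
    · rintro _ ⟨d, hd, rfl⟩
      exact exists_mul_pInt_mul hd
    · rintro _ ⟨d, hd, rfl⟩
      exact exists_pInt_mul_mul hd

theorem exists_iso_idealHalf (m : ℕ) (n : ℂ) :
    ∃ f : BasicConstruction (epsMerge m n) →ₙₐ[ℂ] half (m + 1) n,
      (∀ b₁ b₂ : PartitionAlgebra (m + 1) n, f (BasicConstruction.tmul _ b₁ b₂) =
        toHalf (m + 1) n b₁ * pHalf m n * toHalf (m + 1) n b₂) ∧
      Function.Injective f ∧ Set.range f = idealHalf (m + 1) n := by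
  classical
  obtain ⟨f, hf⟩ := BasicConstruction.exists_hom (j := toHalf (m + 1) n) (p := pHalf m n)
    (epsMerge m n) pHalf_mul_toHalf pHalf_mul_mul_pHalf
  let I : Set (half (m + 1) n) := {x | ∃ (d : Diagram (m + 2)) (hd : d.IsHalf),
    (d.pn : ℚ) < (m + 1 : ℕ) + 1 / 2 ∧ x = diagHalf n d hd}
  have hI : ∀ G : half (m + 1) n → BasicConstruction (epsMerge m n),
      ∃ g : half (m + 1) n →ₗ[ℂ] BasicConstruction (epsMerge m n),
        ∀ x ∈ I, g x = G x := fun G => by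
    refine ⟨lift n (fun d => if h : d.IsHalf then G (diagHalf n d h) else 0) ∘ₗ
      (half (m + 1) n).val.toLinearMap, ?_⟩
    rintro _ ⟨d, hd, -, rfl⟩
    exact (lift_diag (n := n) _ d).trans (dif_pos hd)
  have hmul : ∀ b₁ ∈ Set.range (diag n : Diagram (m + 1) → _),
      ∀ b₂ ∈ Set.range (diag n : Diagram (m + 1) → _), ∃ c : ℂ,
        ∃ x ∈ I,
          toHalf (m + 1) n b₁ * pHalf m n * toHalf (m + 1) n b₂ = c • x := by
    rintro _ ⟨d, rfl⟩ _ ⟨e, rfl⟩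
    have hd := ((isHalf_addStrand d).comp (isHalf_pHalf (Fin.last m))).comp (isHalf_addStrand e)
    have hpn := pn_comp_lt_left (e := e.addStrand)
      (pn_comp_lt_right (d := d.addStrand) (pn_pHalf_lt (Fin.last m)))
    refine ⟨n ^ (loops d.addStrand (Diagram.pHalf (Fin.last m)) +
      loops (comp d.addStrand (Diagram.pHalf (Fin.last m))) e.addStrand), diagHalf n _ hd, ⟨_, hd, natCast_lt_add_half.2 hpn, rfl⟩, Subtype.ext ?_⟩
    rw [toHalf_diag, toHalf_diag]
    exact diag_mul_mul d.addStrand (Diagram.pHalf (Fin.last m)) e.addStrand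
  have hR : ∀ x ∈ I, ∃ w v, x * w * pHalf m n * v = x := by
    rintro _ ⟨d, hd, hpn, rfl⟩
    exact exists_mul_pHalf_mul hd (natCast_lt_add_half.1 hpn)
  have hL : ∀ x ∈ I, ∃ w v, w * pHalf m n * v * x = x := by
    rintro _ ⟨d, hd, hpn, rfl⟩
    exact exists_pHalf_mul_mul hd (natCast_lt_add_half.1 hpn)
  refine ⟨f, hf, ?_⟩
  refine BasicConstruction.injective_and_range_of_regular (j := toHalf (m + 1) n) (I := I)
    (ε := epsMerge m n) (S := Set.range (diag n)) (epsRemove (m + 1) n) (p := pHalf m n)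
    ?_ ?_ ?_ ?_ ?_ f hf ?_ ?_ ?_ ?_ ?_ ?_
  · exact pHalf_mul_toHalf
  · exact pHalf_mul_mul_pHalf
  · exact epsRemove_pHalf
  · exact mul_pHalf
  · exact pHalf_mul
  · exact span_diag
  · exact ⟨one _, one_def.symm⟩
  · exact hI
  · exact hmul
  · exact hR
  · exact hL
end PartitionAlgebra

theorem mainTheorem9 (n : ℂ) :
    -- for integers `k = m + 1 ≥ 1`
    (∀ m : ℕ, ∃ f : BasicConstruction (PartitionAlgebra.epsRemove m n) →ₙₐ[ℂ]
        PartitionAlgebra (m + 1) n,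
      (∀ b₁ b₂ : PartitionAlgebra.half m n,
        f (BasicConstruction.tmul _ b₁ b₂) =
          (b₁ : PartitionAlgebra (m + 1) n) * PartitionAlgebra.pInt m n * b₂) ∧
      Function.Injective f ∧
      Set.range f = PartitionAlgebra.idealInt (m + 1) n) ∧
    -- for half-integers `k = m + 1 + 1/2 ≥ 3/2`
    (∀ m : ℕ, ∃ f : BasicConstruction (PartitionAlgebra.epsMerge m n) →ₙₐ[ℂ]
        PartitionAlgebra.half (m + 1) n,
      (∀ b₁ b₂ : PartitionAlgebra (m + 1) n,
        f (BasicConstruction.tmul _ b₁ b₂) =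
          PartitionAlgebra.toHalf (m + 1) n b₁ * PartitionAlgebra.pHalf m n *
            PartitionAlgebra.toHalf (m + 1) n b₂) ∧
      Function.Injective f ∧
      Set.range f = PartitionAlgebra.idealHalf (m + 1) n) ∧
    -- for integers `k = m ≥ 0`
    (∀ m : ℕ, ∃ (J : Ideal (PartitionAlgebra m n)) (_ : J.IsTwoSided),
      (J : Set (PartitionAlgebra m n)) = PartitionAlgebra.idealInt m n ∧
      ∃ e : (PartitionAlgebra m n ⧸ J) ≃ₐ[ℂ] MonoidAlgebra ℂ (Equiv.Perm (Fin m)),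
        ∀ σ : Equiv.Perm (Fin m),
          e (Ideal.Quotient.mk J (PartitionAlgebra.diag n (Diagram.ofPerm σ))) =
            MonoidAlgebra.of ℂ (Equiv.Perm (Fin m)) σ) ∧
    -- for half-integers `k = m + 1/2 ≥ 1/2`
    (∀ m : ℕ, ∃ (J : Ideal (PartitionAlgebra.half m n)) (_ : J.IsTwoSided),
      (J : Set (PartitionAlgebra.half m n)) = PartitionAlgebra.idealHalf m n ∧
      ∃ e : (PartitionAlgebra.half m n ⧸ J) ≃ₐ[ℂ] MonoidAlgebra ℂ (Equiv.Perm (Fin m)),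
        ∀ σ : Equiv.Perm (Fin m),
          e (Ideal.Quotient.mk J (PartitionAlgebra.toHalf m n
              (PartitionAlgebra.diag n (Diagram.ofPerm σ)))) =
            MonoidAlgebra.of ℂ (Equiv.Perm (Fin m)) σ) :=
  ⟨fun m => PartitionAlgebra.exists_iso_idealInt m n,
    fun m => PartitionAlgebra.exists_iso_idealHalf m n,
    fun m => PartitionAlgebra.exists_quotient_idealInt m n,
    fun m => PartitionAlgebra.exists_quotient_idealHalf m n⟩
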